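/- For integers $n\ge 1$ and $d\ge 2$ put $\nu=\frac d2-1$ and let $$W_n(\nu;s)=\mathbb E\,\|X_1+\cdots+X_n\|^s,$$ where $X_1,\dots,X_n$ are independent random vectors, each uniformly distributed on the unit sphere of $\mathbb R^d$; that is, $W_n(\nu;s)$ is the $s$-th moment of the distance to the origin after $n$ uniform unit steps in $\mathbb R^d$. Let $\nu\ge 0$ be an integer (so $d=2\nu+2$). Let ${}_2F_1\!\left(\tfrac13,\tfrac23;1+\nu;z\right)$ denote the principal branch of the Gauss hypergeometric function, i.e. the holomorphic function on $\mathbb C\setminus[1,\infty)$ which equals $\sum_{m\ge0}\frac{(1/3)_m(2/3)_m}{(1+\nu)_m}\frac{z^m}{m!}$ for $|z|<1$. For every complex $x$ with $|x|<1/9$ one has $1+3x\neq0$ and $\frac{27x(1-x)^2}{(1+3x)^3}\notin[1,\infty)$, and there is a polynomial $q_\nu$ such that for all complex $x$ with $0<|x|<1/9$ the series on the left converges and $$\sum_{k=0}^{\infty}W_3(\nu;2k)\,x^k=\frac{(-1)^\nu}{\binom{2\nu}{\nu}}\,\frac{(1-1/x)^{2\nu}}{1+3x}\;{}_2F_1\!\left(\tfrac13,\tfrac23;1+\nu;\frac{27x(1-x)^2}{(1+3x)^3}\right)-q_\nu\!\left(\frac1x\right).$$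 Here $q_\nu(1/x)$ is the principal part at $x=0$ of the hypergeometric term on the right-hand side: $q_\nu(0)=0$, and the hypergeometric term minus $q_\nu(1/x)$ extends analytically to $x=0$. -/

import Mathlib

open MeasureTheory Filter Topology

noncomputable section

/-- The uniform probability distribution on the unit sphere of `ℝ^d`, regarded as a measure on
`ℝ^d`: the surface measure of the sphere, normalized to total mass `1`. -/
def uniformStep (d : ℕ) : Measure (EuclideanSpace ℝ (Fin d)) :=
  let σ := (volume : Measure (EuclideanSpace ℝ (Fin d))).toSphere
  Measure.map Subtype.val ((σ Set.univ)⁻¹ • σ)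

/-- The law of the distance to the origin after `n` independent uniform unit steps in `ℝ^d`. -/
def walkDistance (n d : ℕ) : Measure ℝ :=
  Measure.map (fun ω : Fin n → EuclideanSpace ℝ (Fin d) => ‖∑ i, ω i‖)
    (Measure.pi fun _ : Fin n => uniformStep d)

/-- The moment `W_n(ν; s)`, where `ν = d / 2 - 1`: the `s`-th moment of the distance to the origin
after `n` uniform unit steps in `ℝ^d`. -/
def walkMoment (n d : ℕ) (s : ℝ) : ℝ :=
  ∫ r, r ^ s ∂(walkDistance n d)

/-- The complex plane cut along the real ray `[1, ∞)`. -/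
def cutPlane : Set ℂ := {z | ¬ ∃ t : ℝ, 1 ≤ t ∧ z = t}

/-- `F` is, on the plane cut along `[1, ∞)`, the principal branch of the Gauss hypergeometric
function with parameters `a, b; c`: it is holomorphic there and is given by the hypergeometric
series on the unit disc. Since the cut plane is connected, this determines `F` on it. -/
def IsPrincipalHypergeometric (a b c : ℂ) (F : ℂ → ℂ) : Prop :=
  DifferentiableOn ℂ F cutPlane ∧ ∀ z : ℂ, ‖z‖ < 1 → F z = ₂F₁ a b c z

open Classical in
/-- The principal branch of the Gauss hypergeometric function: the analytic continuation of the
hypergeometric series to the cut plane. -/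
def hyp2F1 (a b c : ℂ) : ℂ → ℂ :=
  if h : ∃ F, IsPrincipalHypergeometric a b c F then h.choose else fun _ => 0

/-- The rational function `27 x (1 - x)² / (1 + 3 x)³`. -/
def hypArg (x : ℂ) : ℂ := 27 * x * (1 - x) ^ 2 / (1 + 3 * x) ^ 3

/-- The hypergeometric term of the generating function. -/
def hypTerm (ν : ℕ) (x : ℂ) : ℂ :=
  (-1) ^ ν / ((2 * ν).choose ν : ℂ) * ((1 - 1 / x) ^ (2 * ν) / (1 + 3 * x)) *
    hyp2F1 (1 / 3) (2 / 3) (1 + ν) (hypArg x)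

/-- `q(1 / x)` is the principal part at `x = 0` of `f`: only negative powers of `x` occur in it,
and `f(x) - q(1 / x)` extends analytically to `x = 0`. -/
def IsPrincipalPartAtZero (f : ℂ → ℂ) (q : Polynomial ℂ) : Prop :=
  q.coeff 0 = 0 ∧
    ∃ g : ℂ → ℂ, AnalyticAt ℂ g 0 ∧ ∀ᶠ x in 𝓝[≠] (0 : ℂ), f x = g x + q.eval (1 / x)

end

/-!
The argument identifies both sides of the identity, up to a polynomial, with one period integral.

*From moments to a resolvent.* Conditioning on one step at a time, the even moments are iterated
averages over uniform unit steps (`walkMoment_even`). A step `X` from a point `a` leads to squared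
distance `1 + ‖a‖² + 2⟨a, X⟩`, and a coordinate of `X` is distributed like `sin φ` with density
proportional to `cos ^ (2ν) φ` (`integral_uniformStep_comp_inner`; its moments are computed by
comparing a Gaussian integral in polar and in Cartesian coordinates, and Weierstrass' theorem does
the rest). Summing a geometric series under the integral sign shows that the generating function is
`E[1 / (1 - x R²)]`, where `R` is the distance after three steps (`hasSum_walkMoment_three`).

*From the resolvent to a period integral.* After two steps the squared distance is
`s = 2 + 2 sin θ`. The average of `1 / (1 - x R²)` over the third step is elementary: in the plane
it is `Q ^ (-1/2)` with `Q = (1 - x (1 + s))² - 4 x² s`, and a recurrence raising the dimension by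
two shows that, after multiplication by `(4 x² s) ^ ν`, it is a multiple of `Q ^ (ν - 1/2)` plus a
polynomial of degree less than `2ν` in `x` (`exists_stepResolvent_eq`). The weight of the second step
is `cos ^ (2ν) θ = ((1 - sin θ) / 2) ^ ν s ^ ν`, so the power of `s` cancels, and `x ^ (2ν)` times the
generating function is a multiple of `∫ ((1 - sin θ) / 2) ^ ν Q ^ (ν - 1/2) dθ` plus such a
polynomial (`exists_walkResolvent_eq`). Divided by `x ^ (2ν)`, the polynomial contributes only
negative powers of `x`: it is the source of the principal part.

*From the period integral to the hypergeometric function.* The period integral satisfies a second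
order linear differential equation (`periodIntegral_ode`, by an explicit antiderivative), which is
also Gauss' equation pulled back along `27x(1-x)²/(1+3x)³` (`hypRegular_ode`). It has a regular
singular point at `0` with exponents `0` and `-ν`, so an analytic solution is determined by its
value there, and the two solutions are proportional near `0` (`periodIntegral_eventually_eq`).

*Continuation to `|x| < 1/9`.* Euler's integral continues the hypergeometric series to the cut plane
(`exists_isPrincipalHypergeometric`), the argument `27x(1-x)²/(1+3x)³` stays in the cut plane for
`|x| < 1/9` (`hypArg_mem_cutPlane`), and the identity theorem extends the identity from a
neighbourhood of `0` to this disc (`exists_pow_mul_walkResolvent_eq`).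
-/

/-! ### The principal branch of the hypergeometric function -/

/-- Differentiation under the integral sign when the integrand is an integrable weight times a
kernel which is jointly continuous, together with its parameter derivative. -/
lemma hasDerivAt_integral_weight_mul {U : Set ℂ} (hU : IsOpen U) {a b : ℝ} {w : ℝ → ℂ}
    {k k' : ℂ → ℝ → ℂ} (hw : IntervalIntegrable w volume a b)
    (hk : ContinuousOn (Function.uncurry k) (U ×ˢ Set.uIcc a b))
    (hk' : ContinuousOn (Function.uncurry k') (U ×ˢ Set.uIcc a b))
    (hd : ∀ z ∈ U, ∀ t ∈ Set.uIcc a b, HasDerivAt (fun z => k z t) (k' z t) z) {z : ℂ}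
    (hz : z ∈ U) :
    HasDerivAt (fun z => ∫ t in a..b, w t * k z t) (∫ t in a..b, w t * k' z t) z := by
  obtain ⟨r, hr, hrU⟩ := Metric.nhds_basis_closedBall.mem_iff.1 (hU.mem_nhds hz)
  have hslice : ∀ {f : ℂ → ℝ → ℂ}, ContinuousOn (Function.uncurry f) (U ×ˢ Set.uIcc a b) →
      ∀ y ∈ U, IntervalIntegrable (fun t => w t * f y t) volume a b := by
    intro f hf y hy
    refine hw.mul_continuousOn ?_
    have : ContinuousOn (fun t : ℝ => Function.uncurry f (y, t)) (Set.uIcc a b) :=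
      hf.comp (by fun_prop) (fun t ht => ⟨hy, ht⟩)
    exact this
  have hK : IsCompact (Metric.closedBall z r ×ˢ Set.uIcc a b) :=
    (isCompact_closedBall z r).prod isCompact_uIcc
  obtain ⟨M, hM⟩ := hK.exists_bound_of_continuousOn
    (hk'.mono (Set.prod_mono hrU subset_rfl))
  refine (intervalIntegral.hasDerivAt_integral_of_dominated_loc_of_deriv_le
    (F := fun z t => w t * k z t) (F' := fun z t => w t * k' z t)
    (bound := fun t => ‖w t‖ * M) (Metric.closedBall_mem_nhds z hr) ?_ (hslice hk z hz)
    (intervalIntegrable_iff.1 (hslice hk' z hz)).aestronglyMeasurable ?_ (hw.norm.mul_const M) ?_).2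
  · filter_upwards [hU.mem_nhds hz] with y hy
    exact (intervalIntegrable_iff.1 (hslice hk y hy)).aestronglyMeasurable
  · refine Eventually.of_forall fun t ht y hy => ?_
    rw [norm_mul]
    exact mul_le_mul_of_nonneg_left (hM (y, t) ⟨hy, Set.uIoc_subset_uIcc ht⟩) (norm_nonneg _)
  · exact Eventually.of_forall fun t ht y hy =>
      (hd y (hrU hy) t (Set.uIoc_subset_uIcc ht)).const_mul (w t)

lemma isOpen_cutPlane : IsOpen cutPlane := by
  have : cutPlane = (fun z : ℂ => 1 - z) ⁻¹' Complex.slitPlane := by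
    ext z
    simp only [cutPlane, Set.mem_ofPred_eq, Set.mem_preimage, Complex.mem_slitPlane_iff_not_le_zero,
      not_iff_not, Complex.le_def]
    constructor
    · rintro ⟨t, ht, rfl⟩
      simpa using ht
    · rintro ⟨h1, h2⟩
      refine ⟨z.re, by simpa using h1, Complex.ext (by simp) ?_⟩
      simpa using h2
  rw [this]
  exact Complex.isOpen_slitPlane.preimage (by fun_prop)

lemma one_sub_mul_mem_slitPlane {z : ℂ} (hz : z ∈ cutPlane) {t : ℝ} (ht : t ∈ Set.Icc (0 : ℝ) 1) :
    1 - z * t ∈ Complex.slitPlane := by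
  rw [Complex.mem_slitPlane_iff_not_le_zero, Complex.le_def]
  rintro ⟨h1, h2⟩
  simp at h1 h2
  rcases h2 with h2 | h2
  · refine hz ⟨z.re, ?_, Complex.ext (by simp) (by simp [h2])⟩
    by_contra! hlt
    have h3 : t = 1 := le_antisymm ht.2 (by nlinarith [ht.1])
    rw [h3] at h1
    linarith
  · simp [h2] at h1
    linarith

lemma hasFPowerSeriesOnBall_ordinaryHypergeometric {a b c : ℂ}
    (habc : ∀ k : ℕ, (k : ℂ) ≠ -a ∧ (k : ℂ) ≠ -b ∧ (k : ℂ) ≠ -c) :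
    HasFPowerSeriesOnBall (fun z : ℂ => ₂F₁ a b c z)
      (ordinaryHypergeometricSeries ℂ a b c) 0 1 := by
  have h := (ordinaryHypergeometricSeries ℂ a b c).hasFPowerSeriesOnBall (by
    rw [ordinaryHypergeometricSeries_radius_eq_one ℂ a b c habc]; exact one_pos)
  rwa [ordinaryHypergeometricSeries_radius_eq_one ℂ a b c habc] at h

lemma hasSum_ordinaryHypergeometric {a b c : ℂ}
    (habc : ∀ k : ℕ, (k : ℂ) ≠ -a ∧ (k : ℂ) ≠ -b ∧ (k : ℂ) ≠ -c) {z : ℂ} (hz : ‖z‖ < 1) :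
    HasSum (fun n => ordinaryHypergeometricCoefficient a b c n * z ^ n) (₂F₁ a b c z) := by
  have := (hasFPowerSeriesOnBall_ordinaryHypergeometric habc).hasSum (y := z) (by
    simpa [enorm_eq_nnnorm, ← NNReal.coe_lt_coe] using hz)
  simpa [ordinaryHypergeometricSeries, FormalMultilinearSeries.ofScalars_apply_eq, mul_comm]
    using this

lemma hasSum_one_sub_cpow (a : ℂ) {z : ℂ} (hz : ‖z‖ < 1) :
    HasSum (fun n => ((n.factorial : ℂ)⁻¹ * (ascPochhammer ℂ n).eval a) * z ^ n)
      ((1 - z) ^ (-a)) := by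
  have h := (Complex.one_add_cpow_hasFPowerSeriesOnBall_zero (a := -a)).hasSum (y := -z) (by
    simpa [enorm_eq_nnnorm, ← NNReal.coe_lt_coe] using hz)
  rw [binomialSeries_eq_ordinaryHypergeometricSeries (b := 1)
    (fun k hk => by
      have h1 := congrArg Complex.re hk
      simp at h1
      have : (0 : ℝ) ≤ k := k.cast_nonneg
      linarith)] at h
  have h1 : ∀ n : ℕ, (ascPochhammer ℂ n).eval 1 ≠ 0 := fun n => by
    rw [ascPochhammer_eval_one]; exact_mod_cast n.factorial_ne_zero
  rw [zero_add, ← sub_eq_add_neg] at h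
  refine h.congr_fun fun n => ?_
  rw [ordinaryHypergeometricSeries, FormalMultilinearSeries.ofScalars_comp_neg_id,
    FormalMultilinearSeries.ofScalars_apply_eq, neg_neg, smul_eq_mul, neg_pow z,
    ordinaryHypergeometricCoefficient, mul_assoc _ _ (_⁻¹), mul_inv_cancel₀ (h1 n), mul_one]
  have : ((-1 : ℂ) ^ n) * (-1) ^ n = 1 := by rw [← mul_pow]; simp
  linear_combination (-(n.factorial : ℂ)⁻¹ * (ascPochhammer ℂ n).eval a * z ^ n) * this

/-- The moments of the beta weight. -/
lemma betaIntegral_add_nat {b c : ℂ} (hb : 0 < b.re) (hc : b.re < c.re) (n : ℕ) :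
    Complex.betaIntegral (b + n) (c - b) = Complex.betaIntegral b (c - b) *
      ((ascPochhammer ℂ n).eval b * ((ascPochhammer ℂ n).eval c)⁻¹) := by
  have hne : ∀ {w : ℂ}, 0 < w.re → ∀ k : ℕ, w ≠ -k := fun hw k h => by
    have := congrArg Complex.re h
    simp at this
    have h2 : (0 : ℝ) ≤ k := k.cast_nonneg
    linarith
  have hcb : 0 < (c - b).re := by simpa using hc
  have hc0 : 0 < c.re := hb.trans hc
  have hbn : 0 < (b + n).re := by simp; positivity
  have hcn : 0 < (c + n).re := by simp; positivity
  have h1 := Complex.Gamma_mul_Gamma_eq_betaIntegral hb hcb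
  have h2 := Complex.Gamma_mul_Gamma_eq_betaIntegral hbn hcb
  rw [add_sub_cancel] at h1
  rw [show b + n + (c - b) = c + n by ring] at h2
  have g1 := Complex.Gamma_ne_zero_of_re_pos hb
  have g2 := Complex.Gamma_ne_zero_of_re_pos hc0
  have g3 := Complex.Gamma_ne_zero_of_re_pos hcn
  rw [← Complex.Gamma_add_nat_div_Gamma_eq b (hne hb),
    ← Complex.Gamma_add_nat_div_Gamma_eq c (hne hc0)]
  field_simp
  linear_combination -Complex.Gamma b * h2 + Complex.Gamma (b + n) * h1

/-- The Euler integral `∫₀¹ t^(b-1) (1-t)^(c-b-1) (1-zt)^(-a) dt` continues the hypergeometric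
series to the cut plane. -/
lemma exists_isPrincipalHypergeometric {a b c : ℂ} (hb : 0 < b.re) (hc : b.re < c.re)
    (ha : ∀ k : ℕ, (k : ℂ) ≠ -a) : ∃ F, IsPrincipalHypergeometric a b c F := by
  have hne : ∀ {w : ℂ}, 0 < w.re → ∀ k : ℕ, (k : ℂ) ≠ -w := fun hw k h => by
    have := congrArg Complex.re h
    simp at this
    have h2 : (0 : ℝ) ≤ k := k.cast_nonneg
    linarith
  have hcb : 0 < (c - b).re := by simpa using hc
  have habc : ∀ k : ℕ, (k : ℂ) ≠ -a ∧ (k : ℂ) ≠ -b ∧ (k : ℂ) ≠ -c := fun k =>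
    ⟨ha k, hne hb k, hne (hb.trans hc) k⟩
  have hB : Complex.betaIntegral b (c - b) ≠ 0 := by
    intro h
    have h1 := Complex.Gamma_mul_Gamma_eq_betaIntegral hb hcb
    rw [h, mul_zero] at h1
    exact mul_ne_zero (Complex.Gamma_ne_zero_of_re_pos hb) (Complex.Gamma_ne_zero_of_re_pos hcb) h1
  set w : ℝ → ℂ := fun t => (t : ℂ) ^ (b - 1) * (1 - (t : ℂ)) ^ (c - b - 1) with hw_def
  have hw : IntervalIntegrable w volume 0 1 := Complex.betaIntegral_convergent hb hcb
  refine ⟨fun z => (Complex.betaIntegral b (c - b))⁻¹ * ∫ t in (0 : ℝ)..1, w t * (1 - z * t) ^ (-a),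
    ?_, ?_⟩
  · refine DifferentiableOn.const_mul (fun z hz => ?_) _
    have hcont : ∀ e : ℂ, ContinuousOn (fun p : ℂ × ℝ => (1 - p.1 * p.2) ^ e)
        (cutPlane ×ˢ Set.uIcc (0 : ℝ) 1) := fun e => by
      refine ContinuousOn.cpow (by fun_prop) continuousOn_const fun p hp => ?_
      rw [Set.uIcc_of_le zero_le_one] at hp
      exact one_sub_mul_mem_slitPlane hp.1 hp.2
    refine (hasDerivAt_integral_weight_mul isOpen_cutPlane hw
      (k := fun z t => (1 - z * t) ^ (-a)) (hcont (-a))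
      (k' := fun z t => -a * (1 - z * t) ^ (-a - 1) * (-t)) ?_ ?_ hz).differentiableAt
      |>.differentiableWithinAt
    · have := hcont (-a - 1)
      simp only [Function.uncurry_def]
      fun_prop
    · intro z hz t ht
      rw [Set.uIcc_of_le zero_le_one] at ht
      have h1 : HasDerivAt (fun z : ℂ => 1 - z * t) (-t : ℂ) z := by
        simpa using ((hasDerivAt_id z).mul_const (t : ℂ)).const_sub 1
      exact h1.cpow_const (one_sub_mul_mem_slitPlane hz ht)
  · intro z hz
    have key : HasSum (fun n => ∫ t in (0 : ℝ)..1, w t *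
        (((n.factorial : ℂ)⁻¹ * (ascPochhammer ℂ n).eval a) * (z * t) ^ n))
        (∫ t in (0 : ℝ)..1, w t * (1 - z * t) ^ (-a)) := by
      have hs : Summable fun n : ℕ =>
          ‖((n.factorial : ℂ)⁻¹ * (ascPochhammer ℂ n).eval a) * z ^ n‖ :=
        (hasSum_one_sub_cpow a hz).summable.norm
      refine intervalIntegral.hasSum_integral_of_dominated_convergence
        (fun n t => ‖w t‖ * ‖((n.factorial : ℂ)⁻¹ * (ascPochhammer ℂ n).eval a) * z ^ n‖)
        ?_ ?_ ?_ ?_ ?_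
      · intro n
        exact (intervalIntegrable_iff.1 (hw.mul_continuousOn
          (by fun_prop))).aestronglyMeasurable
      · refine fun n => Eventually.of_forall fun t ht => ?_
        rw [Set.uIoc_of_le zero_le_one] at ht
        rw [mul_pow, ← mul_assoc _ (z ^ n), norm_mul (w t), norm_mul _ ((t : ℂ) ^ n), norm_pow,
          Complex.norm_real, Real.norm_eq_abs, abs_of_pos ht.1]
        gcongr
        exact mul_le_of_le_one_right (norm_nonneg _) (pow_le_one₀ ht.1.le ht.2)
      · exact Eventually.of_forall fun t ht => hs.mul_left _
      · simp_rw [tsum_mul_left]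
        exact hw.norm.mul_const _
      · refine Eventually.of_forall fun t ht => ?_
        rw [Set.uIoc_of_le zero_le_one] at ht
        refine (hasSum_one_sub_cpow a ?_).mul_left _
        rw [norm_mul, Complex.norm_real, Real.norm_eq_abs, abs_of_pos ht.1]
        exact (mul_le_of_le_one_right (norm_nonneg _) ht.2).trans_lt hz
    have hterm : ∀ n : ℕ, ∫ t in (0 : ℝ)..1, w t *
        (((n.factorial : ℂ)⁻¹ * (ascPochhammer ℂ n).eval a) * (z * t) ^ n) =
        Complex.betaIntegral b (c - b) * (ordinaryHypergeometricCoefficient a b c n * z ^ n) := by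
      intro n
      have h1 : ∫ t in (0 : ℝ)..1, w t *
          (((n.factorial : ℂ)⁻¹ * (ascPochhammer ℂ n).eval a) * (z * t) ^ n) =
          ∫ t in (0 : ℝ)..1, ((n.factorial : ℂ)⁻¹ * (ascPochhammer ℂ n).eval a * z ^ n) *
            ((t : ℂ) ^ (b + n - 1) * (1 - (t : ℂ)) ^ (c - b - 1)) := by
        refine intervalIntegral.integral_congr_ae (Eventually.of_forall fun t ht => ?_)
        rw [Set.uIoc_of_le zero_le_one] at ht
        have ht0 : (t : ℂ) ≠ 0 := by exact_mod_cast ht.1.ne'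
        rw [show b + n - 1 = (b - 1) + n by ring, Complex.cpow_add _ _ ht0, Complex.cpow_natCast,
          hw_def]
        ring
      rw [h1, intervalIntegral.integral_const_mul]
      have h2 := betaIntegral_add_nat hb hc n
      rw [Complex.betaIntegral] at h2
      rw [h2]
      unfold ordinaryHypergeometricCoefficient
      ring
    simp_rw [hterm] at key
    have h3 := (key.mul_left (Complex.betaIntegral b (c - b))⁻¹).unique
      (by simpa [inv_mul_cancel_left₀ hB] using hasSum_ordinaryHypergeometric habc hz)
    exact h3

lemma hyp2F1_spec (ν : ℕ) :
    IsPrincipalHypergeometric (1 / 3) (2 / 3) (1 + ν) (hyp2F1 (1 / 3) (2 / 3) (1 + ν)) := by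
  have h : ∃ F, IsPrincipalHypergeometric (1 / 3) (2 / 3) (1 + ν) F := by
    refine exists_isPrincipalHypergeometric (by norm_num) ?_ fun k hk => ?_
    · have : (0 : ℝ) ≤ ν := ν.cast_nonneg
      norm_num
      linarith
    · have h1 := congrArg Complex.re hk
      have : (0 : ℝ) ≤ k := k.cast_nonneg
      norm_num at h1
      linarith
  rw [hyp2F1, dif_pos h]
  exact h.choose_spec

/-! ### The hypergeometric differential equation and its regular singular point -/

/-- Termwise differentiation of a power series in one variable. -/
lemma HasFPowerSeriesOnBall.exists_deriv {f : ℂ → ℂ} {p : FormalMultilinearSeries ℂ ℂ ℂ} {x : ℂ}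
    {r : ENNReal} (h : HasFPowerSeriesOnBall f p x r) :
    ∃ q : FormalMultilinearSeries ℂ ℂ ℂ, HasFPowerSeriesOnBall (deriv f) q x r ∧
      ∀ n : ℕ, q.coeff n = (n + 1) * p.coeff (n + 1) := by
  refine ⟨_, (ContinuousLinearMap.apply ℂ ℂ (1 : ℂ)).comp_hasFPowerSeriesOnBall h.fderiv,
    fun n => ?_⟩
  have := p.derivSeries_coeff_one n
  rw [nsmul_eq_mul] at this
  push_cast at this
  exact this

lemma HasSum.shift_mul_pow {g : ℕ → ℂ} {z S : ℂ} (hg : g 0 = 0)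
    (h : HasSum (fun n => g (n + 1) * z ^ n) S) : HasSum (fun n => g n * z ^ n) (z * S) := by
  rw [← hasSum_nat_add_iff' 1]
  simp only [Finset.range_one, Finset.sum_singleton, hg, zero_mul, sub_zero]
  refine (h.mul_left z).congr_fun fun n => ?_
  ring

lemma HasFPowerSeriesOnBall.hasSum_coeff {f : ℂ → ℂ} {p : FormalMultilinearSeries ℂ ℂ ℂ}
    (h : HasFPowerSeriesOnBall f p 0 1) {z : ℂ} (hz : ‖z‖ < 1) :
    HasSum (fun n => p.coeff n * z ^ n) (f z) := by
  have := h.hasSum (y := z) (by simpa [enorm_eq_nnnorm, ← NNReal.coe_lt_coe] using hz)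
  rw [zero_add] at this
  refine this.congr_fun fun n => ?_
  rw [FormalMultilinearSeries.apply_eq_pow_smul_coeff, smul_eq_mul, mul_comm]

lemma ordinaryHypergeometricCoefficient_succ {a b c : ℂ} (hc : ∀ k : ℕ, (k : ℂ) ≠ -c) (n : ℕ) :
    (n + 1) * (c + n) * ordinaryHypergeometricCoefficient a b c (n + 1) =
      (a + n) * (b + n) * ordinaryHypergeometricCoefficient a b c n := by
  have h1 : c + n ≠ 0 := fun h => hc n (by linear_combination h)
  have h2 : (ascPochhammer ℂ n).eval c ≠ 0 := by
    rw [Ne, ascPochhammer_eval_eq_zero_iff]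
    rintro ⟨k, -, hk⟩
    exact hc k hk
  have h3 : (n.factorial : ℂ) ≠ 0 := by exact_mod_cast n.factorial_ne_zero
  have h4 : (n + 1 : ℂ) ≠ 0 := by exact_mod_cast n.succ_ne_zero
  simp only [ordinaryHypergeometricCoefficient, ascPochhammer_succ_eval, Nat.factorial_succ]
  push_cast
  field_simp

/-- Gauss' hypergeometric differential equation in the unit disc. -/
lemma ordinaryHypergeometric_ode {a b c : ℂ}
    (habc : ∀ k : ℕ, (k : ℂ) ≠ -a ∧ (k : ℂ) ≠ -b ∧ (k : ℂ) ≠ -c) :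
    ∃ Y₁ Y₂ : ℂ → ℂ, ∀ z : ℂ, ‖z‖ < 1 →
      HasDerivAt (fun z => ₂F₁ a b c z) (Y₁ z) z ∧ HasDerivAt Y₁ (Y₂ z) z ∧
      z * (1 - z) * Y₂ z + (c - (a + b + 1) * z) * Y₁ z - a * b * ₂F₁ a b c z = 0 := by
  have h0 := hasFPowerSeriesOnBall_ordinaryHypergeometric habc
  obtain ⟨q1, h1, hq1⟩ := h0.exists_deriv
  obtain ⟨q2, h2, hq2⟩ := h1.exists_deriv
  refine ⟨deriv fun z => ₂F₁ a b c z, deriv (deriv fun z => ₂F₁ a b c z), fun z hz => ?_⟩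
  have hmem : z ∈ Metric.eball (0 : ℂ) 1 := by
    simpa [enorm_eq_nnnorm, ← NNReal.coe_lt_coe] using hz
  refine ⟨(h0.differentiableOn.differentiableAt (Metric.isOpen_eball.mem_nhds hmem)).hasDerivAt,
    (h1.differentiableOn.differentiableAt (Metric.isOpen_eball.mem_nhds hmem)).hasDerivAt, ?_⟩
  set α := ordinaryHypergeometricCoefficient a b c with hα
  have e0 : ∀ n, (ordinaryHypergeometricSeries ℂ a b c).coeff n = α n := fun n => by
    rw [ordinaryHypergeometricSeries, FormalMultilinearSeries.coeff_ofScalars]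
  have s0 := h0.hasSum_coeff hz
  have s1 := h1.hasSum_coeff hz
  have s2 := h2.hasSum_coeff hz
  simp only [hq2, hq1, e0] at s0 s1 s2
  have t1 : HasSum (fun n : ℕ => (n * α n) * z ^ n) (z * deriv (fun z => ₂F₁ a b c z) z) :=
    HasSum.shift_mul_pow (g := fun n => n * α n) (by simp) (by simpa using s1)
  have t2 : HasSum (fun n : ℕ => (n * (n + 1) * α (n + 1)) * z ^ n)
      (z * deriv (deriv fun z => ₂F₁ a b c z) z) :=
    HasSum.shift_mul_pow (g := fun n => n * (n + 1) * α (n + 1)) (by simp)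
      (s2.congr_fun fun n => by push_cast; ring)
  have t3 : HasSum (fun n : ℕ => (n * (n - 1) * α n) * z ^ n)
      (z * (z * deriv (deriv fun z => ₂F₁ a b c z) z)) :=
    HasSum.shift_mul_pow (g := fun n => n * (n - 1) * α n) (by simp)
      (t2.congr_fun fun n => by push_cast; ring)
  have total := (((t2.sub t3).add (s1.mul_left c)).sub (t1.mul_left (a + b + 1))).sub
    (s0.mul_left (a * b))
  have hz0 : HasSum (fun _ : ℕ => (0 : ℂ)) 0 := hasSum_zero
  have := (total.congr_fun (g := fun _ => 0) fun n => by
    have := ordinaryHypergeometricCoefficient_succ (a := a) (b := b) (fun k => (habc k).2.2) n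
    rw [← hα] at this
    linear_combination (-z ^ n) * this).unique hz0
  linear_combination this

/-- For `|x| < 1/9` the argument `27x(1-x)²/(1+3x)³` avoids the cut. The points where it takes a
value `1 + τ` with `τ ≥ 0` are those with `(1 - 9x)² + τ(1 + 3x)³ = 0`. -/
lemma hypArg_mem_cutPlane {x : ℂ} (hx : ‖x‖ < 1 / 9) : 1 + 3 * x ≠ 0 ∧ hypArg x ∈ cutPlane := by
  have h3 : 1 + 3 * x ≠ 0 := by
    intro h
    have : ‖3 * x‖ = 1 := by
      rw [show 3 * x = -1 by linear_combination h]; simp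
    rw [norm_mul, Complex.norm_ofNat] at this
    linarith
  refine ⟨h3, ?_⟩
  rintro ⟨t, ht, h⟩
  rw [hypArg, div_eq_iff (pow_ne_zero 3 h3)] at h
  have hsq : ‖x‖ ^ 2 < 1 / 81 := by nlinarith [norm_nonneg x]
  rw [← Complex.normSq_eq_norm_sq, Complex.normSq_apply] at hsq
  obtain ⟨p, hp⟩ : ∃ p, p = 3 * x.re := ⟨_, rfl⟩
  obtain ⟨q, hq⟩ : ∃ q, q = 3 * x.im := ⟨_, rfl⟩
  have hx' : x = (p / 3 : ℝ) + (q / 3 : ℝ) * Complex.I := by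
    apply Complex.ext <;> simp [hp, hq]
  have hN : p ^ 2 + q ^ 2 < 1 / 9 := by rw [hp, hq]; nlinarith
  have hp1 : p < 1 / 3 := by nlinarith [sq_nonneg q]
  have hp2 : -(1 / 3) < p := by nlinarith [sq_nonneg q]
  have h' : (1 - 9 * x) ^ 2 + ((t : ℂ) - 1) * (1 + 3 * x) ^ 3 = 0 := by linear_combination -h
  have e : (1 - 9 * x) ^ 2 + ((t : ℂ) - 1) * (1 + 3 * x) ^ 3 =
      ((1 - 6 * p + 9 * (p ^ 2 - q ^ 2) + (t - 1) * ((1 + p) ^ 3 - 3 * (1 + p) * q ^ 2) : ℝ) : ℂ) +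
      ((q * (-6 + 18 * p + (t - 1) * (3 * (1 + p) ^ 2 - q ^ 2)) : ℝ) : ℂ) * Complex.I := by
    rw [hx']
    push_cast
    linear_combination (9 * (q : ℂ) ^ 2 + ((t : ℂ) - 1) * (3 * (1 + p) * q ^ 2 + q ^ 3 * Complex.I))
      * Complex.I_sq
  rw [e] at h'
  have hre := congrArg Complex.re h'
  have him := congrArg Complex.im h'
  simp only [Complex.add_re, Complex.add_im, Complex.ofReal_re, Complex.ofReal_im, Complex.mul_re,
    Complex.mul_im, Complex.I_re, Complex.I_im, Complex.zero_re, Complex.zero_im, mul_zero, mul_one,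
    sub_zero, add_zero, zero_add] at hre him
  rcases mul_eq_zero.1 him with hq0 | him
  · subst hq0
    have : 0 < (1 - 3 * p) ^ 2 := by apply pow_pos; linarith
    have : 0 ≤ (t - 1) * (1 + p) ^ 3 :=
      mul_nonneg (by linarith) (pow_nonneg (by linarith) 3)
    nlinarith
  · -- Eliminating `τ = t - 1` from the real and imaginary parts leaves a polynomial in `p`
    -- and `q ^ 2` which is positive.
    have key : 3 * (1 + p) ^ 2 * (1 - 3 * p) * (3 - p) - q ^ 2 * (46 + 12 * p - 18 * p ^ 2)
        + 9 * (q ^ 2) ^ 2 = 0 := by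
      linear_combination (3 * (1 + p) ^ 2 - q ^ 2) * hre - ((1 + p) ^ 3 - 3 * (1 + p) * q ^ 2) * him
    have d : 0 < 35 - 15 * p + 9 * p ^ 2 + 27 * p ^ 3 := by
      nlinarith [mul_nonneg (sq_nonneg p) (show 0 ≤ 1 / 3 + p by linarith)]
    have e1 : 0 < 46 + 12 * p - 18 * p ^ 2 := by nlinarith [sq_nonneg q]
    have e2 : q ^ 2 * (46 + 12 * p - 18 * p ^ 2) ≤
        (1 / 9 - p ^ 2) * (46 + 12 * p - 18 * p ^ 2) :=
      mul_le_mul_of_nonneg_right (by linarith) e1.le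
    have e3 := mul_pos d (show 0 < 1 - 3 * p by linarith)
    nlinarith [sq_nonneg (q ^ 2)]

/-- A linear differential equation `x p y'' + q y' + r y = 0` with a regular singular point at `0`
and no positive integer exponent there has no analytic solution vanishing at `0` but `0`. -/
lemma eventually_eq_zero_of_regular_singular_ode {D D₁ D₂ p q r : ℂ → ℂ}
    (hD : ∀ᶠ x in 𝓝 (0 : ℂ), HasDerivAt D (D₁ x) x)
    (hD₁ : ∀ᶠ x in 𝓝 (0 : ℂ), HasDerivAt D₁ (D₂ x) x)
    (hp : ContinuousAt p 0) (hq : ContinuousAt q 0) (hr : ContinuousAt r 0)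
    (hpq : ∀ m : ℕ, p 0 * m + q 0 ≠ 0)
    (hode : ∀ᶠ x in 𝓝 (0 : ℂ), x * p x * D₂ x + q x * D₁ x + r x * D x = 0) (h0 : D 0 = 0) :
    ∀ᶠ x in 𝓝 (0 : ℂ), D x = 0 := by
  have hA : AnalyticAt ℂ D 0 :=
    Complex.analyticAt_iff_eventually_differentiableAt.2 (hD.mono fun x hx => hx.differentiableAt)
  by_contra hne
  have hord : analyticOrderAt D 0 ≠ ⊤ := by rwa [Ne, analyticOrderAt_eq_top]
  obtain ⟨g, hg, hg0, hgD⟩ := (hA.analyticOrderAt_ne_top).1 hord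
  set n := analyticOrderNatAt D 0 with hn
  have hn0 : n ≠ 0 := by
    intro hz
    have := hgD.self_of_nhds
    rw [hz, h0] at this
    simp at this
    exact hg0 this.symm
  obtain ⟨m, hm⟩ := Nat.exists_eq_succ_of_ne_zero hn0
  rw [hm] at hgD
  simp only [sub_zero, smul_eq_mul, Nat.succ_eq_add_one] at hgD
  have hgd := hg.eventually_analyticAt
  -- `G` is defined by `D' = x ^ m * G`.
  set G : ℂ → ℂ := fun x => (m + 1) * g x + x * deriv g x with hG
  have hGa : AnalyticAt ℂ G 0 := by
    have := hg.deriv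
    fun_prop
  have hD1 : ∀ᶠ x in 𝓝 (0 : ℂ), D₁ x = x ^ m * G x := by
    filter_upwards [hgD.eventually_nhds, hD, hgd] with x hx hx' hgx
    have h1 : HasDerivAt (fun x => x ^ (m + 1) * g x)
        (((m + 1 : ℕ) : ℂ) * x ^ m * g x + x ^ (m + 1) * deriv g x) x := by
      simpa using (hasDerivAt_pow (m + 1) x).fun_mul hgx.differentiableAt.hasDerivAt
    rw [hx'.unique (h1.congr_of_eventuallyEq hx), hG]
    push_cast
    ring
  have hD2 : ∀ᶠ x in 𝓝 (0 : ℂ), x * D₂ x = x ^ m * (m * G x + x * deriv G x) := by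
    filter_upwards [hD1.eventually_nhds, hD₁, hGa.eventually_analyticAt] with x hx hx' hgx
    have h1 : HasDerivAt (fun x => x ^ m * G x)
        ((m : ℂ) * x ^ (m - 1) * G x + x ^ m * deriv G x) x := by
      simpa using (hasDerivAt_pow m x).fun_mul hgx.differentiableAt.hasDerivAt
    rw [hx'.unique (h1.congr_of_eventuallyEq hx)]
    cases m with
    | zero => simp
    | succ k => push_cast; ring
  have hbr : ∀ᶠ x in 𝓝[≠] (0 : ℂ),
      p x * (m * G x + x * deriv G x) + q x * G x + r x * x * g x = 0 := by
    filter_upwards [hD1.filter_mono nhdsWithin_le_nhds, hD2.filter_mono nhdsWithin_le_nhds,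
      hgD.filter_mono nhdsWithin_le_nhds, hode.filter_mono nhdsWithin_le_nhds,
      self_mem_nhdsWithin] with x h1 h2 h3 h4 hx
    have : x ^ m * (p x * (m * G x + x * deriv G x) + q x * G x + r x * x * g x) = 0 := by
      rw [h1, h3] at h4
      linear_combination h4 - p x * h2
    exact (mul_eq_zero.1 this).resolve_left (pow_ne_zero _ hx)
  have hcont : ContinuousAt
      (fun x => p x * (m * G x + x * deriv G x) + q x * G x + r x * x * g x) 0 := by
    have h1 := hGa.continuousAt
    have h2 := hGa.deriv.continuousAt
    have h3 := hg.continuousAt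
    fun_prop
  have hlim := tendsto_nhds_unique (hcont.tendsto.mono_left nhdsWithin_le_nhds)
    (tendsto_const_nhds.congr' (hbr.mono fun x hx => hx.symm))
  simp only [zero_mul, add_zero, mul_zero, hG] at hlim
  have : (p 0 * m + q 0) * ((m + 1) * g 0) = 0 := by linear_combination hlim
  rcases mul_eq_zero.1 this with h | h
  · exact hpq m h
  · rcases mul_eq_zero.1 h with h | h
    · exact absurd h (by exact_mod_cast m.succ_ne_zero)
    · exact hg0 h

/-! ### The differential equation of the hypergeometric term -/

noncomputable section

/-- The coefficient `p` in the differential equation `x p y'' + q y' + r y = 0` satisfied by both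
`hypRegular` and `periodIntegral`. Its zeros `1` and `1/9` are the inverse squares of the critical
distances `1` and `3` of a walk of three steps. -/
def odeP (x : ℂ) : ℂ := (1 - x) * (1 - 9 * x)

/-- The coefficient `q` in the differential equation `x p y'' + q y' + r y = 0`. -/
def odeQ (ν x : ℂ) : ℂ := (1 + ν) - (20 - 10 * ν) * x + 27 * (1 - ν) * x ^ 2

/-- The coefficient `r` in the differential equation `x p y'' + q y' + r y = 0`. -/
def odeR (ν x : ℂ) : ℂ := -(1 - 2 * ν) * (3 + ν) + 9 * (1 - 2 * ν) * (1 - ν) * x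

/-- The hypergeometric term, freed from its pole at `0` and from its constant. It is built from the
hypergeometric series, so it has its intended meaning only where `‖hypArg x‖ < 1`. -/
def hypRegular (ν : ℕ) (x : ℂ) : ℂ :=
  (1 - x) ^ (2 * ν) / (1 + 3 * x) * ₂F₁ (1 / 3 : ℂ) (2 / 3) (1 + ν) (hypArg x)

end

lemma hasDerivAt_hypArg {x : ℂ} (hx : 1 + 3 * x ≠ 0) :
    HasDerivAt hypArg (27 * (1 - x) * (1 - 9 * x) / (1 + 3 * x) ^ 4) x := by
  have h1 : HasDerivAt (fun x : ℂ => 27 * x * (1 - x) ^ 2)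
      (27 * (1 - x) ^ 2 + 27 * x * (2 * (1 - x) * (-1))) x := by
    have := ((hasDerivAt_id x).const_mul 27).fun_mul (((hasDerivAt_id x).const_sub 1).fun_pow 2)
    simpa using this
  have h2 : HasDerivAt (fun x : ℂ => (1 + 3 * x) ^ 3) (3 * (1 + 3 * x) ^ 2 * 3) x := by
    have := (((hasDerivAt_id x).const_mul 3).const_add 1).fun_pow 3
    simpa using this
  refine (h1.fun_div h2 (pow_ne_zero 3 hx)).congr_deriv ?_
  field_simp
  ring

lemma hypParams_ne (ν : ℕ) (k : ℕ) :
    (k : ℂ) ≠ -(1 / 3) ∧ (k : ℂ) ≠ -(2 / 3) ∧ (k : ℂ) ≠ -(1 + ν) := by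
  have : (0 : ℝ) ≤ k := k.cast_nonneg
  have : (0 : ℝ) ≤ ν := ν.cast_nonneg
  refine ⟨fun h => ?_, fun h => ?_, fun h => ?_⟩ <;>
  · have := congrArg Complex.re h
    norm_num at this
    linarith

lemma eventually_hypArg_small :
    ∀ᶠ x in 𝓝 (0 : ℂ), 1 + 3 * x ≠ 0 ∧ 1 - x ≠ 0 ∧ ‖hypArg x‖ < 1 := by
  have h1 : ContinuousAt (fun x : ℂ => 1 + 3 * x) 0 := by fun_prop
  have h2 : ContinuousAt (fun x : ℂ => 1 - x) 0 := by fun_prop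
  have h3 : ContinuousAt (fun x : ℂ => ‖hypArg x‖) 0 :=
    (hasDerivAt_hypArg (x := 0) (by simp)).continuousAt.norm
  exact (h1.eventually_ne (by simp)).and ((h2.eventually_ne (by simp)).and
    (h3.eventually_lt continuousAt_const (by simp [hypArg])))

/-- The hypergeometric equation, pulled back along `hypArg` and twisted by the prefactor. -/
lemma hypRegular_ode (ν : ℕ) :
    ∃ f₁ f₂ : ℂ → ℂ, ∀ᶠ x in 𝓝 (0 : ℂ),
      HasDerivAt (hypRegular ν) (f₁ x) x ∧ HasDerivAt f₁ (f₂ x) x ∧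
      x * odeP x * f₂ x + odeQ ν x * f₁ x + odeR ν x * hypRegular ν x = 0 := by
  obtain ⟨Y₁, Y₂, hY⟩ := ordinaryHypergeometric_ode (hypParams_ne ν)
  set Y : ℂ → ℂ := fun z => ₂F₁ (1 / 3 : ℂ) (2 / 3) (1 + ν) z with hYdef
  -- the prefactor `g`, its logarithmic derivative `ρ` and the derivative `ζ` of `hypArg`
  set g : ℂ → ℂ := fun x => (1 - x) ^ (2 * ν) / (1 + 3 * x) with hg
  set ρ : ℂ → ℂ := fun x => -(2 * ν) / (1 - x) - 3 / (1 + 3 * x) with hρ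
  set ζ : ℂ → ℂ := fun x => 27 * (1 - x) * (1 - 9 * x) / (1 + 3 * x) ^ 4 with hζ
  have dg : ∀ x : ℂ, 1 + 3 * x ≠ 0 → 1 - x ≠ 0 → HasDerivAt g (g x * ρ x) x := by
    intro x h3 h1
    have e1 : HasDerivAt (fun x : ℂ => (1 - x) ^ (2 * ν))
        (-(2 * ν) * (1 - x) ^ (2 * ν) / (1 - x)) x := by
      have := ((hasDerivAt_id x).const_sub 1).fun_pow (2 * ν)
      refine this.congr_deriv ?_
      cases ν with
      | zero => simp
      | succ n =>
        rw [show 2 * (n + 1) - 1 = 2 * n + 1 by omega, show 2 * (n + 1) = 2 * n + 1 + 1 by omega]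
        simp only [id, pow_succ]
        field_simp
        push_cast
        ring
    have e2 : HasDerivAt (fun x : ℂ => 1 + 3 * x) 3 x := by
      simpa using ((hasDerivAt_id x).const_mul 3).const_add 1
    refine (e1.fun_div e2 h3).congr_deriv ?_
    simp only [hg, hρ]
    have h3' : 1 + x * 3 ≠ 0 := by rwa [mul_comm x]
    field_simp
  have dρ : ∀ x : ℂ, 1 + 3 * x ≠ 0 → 1 - x ≠ 0 →
      HasDerivAt ρ (-(2 * ν) / (1 - x) ^ 2 + 9 / (1 + 3 * x) ^ 2) x := by
    intro x h3 h1
    have e1 : HasDerivAt (fun x : ℂ => 1 - x) (-1) x := by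
      simpa using (hasDerivAt_id x).const_sub 1
    have e2 : HasDerivAt (fun x : ℂ => 1 + 3 * x) 3 x := by
      simpa using ((hasDerivAt_id x).const_mul 3).const_add 1
    have := ((hasDerivAt_const x (-(2 * ν) : ℂ)).fun_div e1 h1).fun_sub
      ((hasDerivAt_const x (3 : ℂ)).fun_div e2 h3)
    refine this.congr_deriv ?_
    field_simp
    ring
  have dζ : ∀ x : ℂ, 1 + 3 * x ≠ 0 →
      HasDerivAt ζ ((27 * (18 * x - 10) * (1 + 3 * x) - 12 * (27 * (1 - x) * (1 - 9 * x)))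
        / (1 + 3 * x) ^ 5) x := by
    intro x h3
    have e1 : HasDerivAt (fun x : ℂ => 27 * (1 - x) * (1 - 9 * x)) (27 * (18 * x - 10)) x := by
      have := ((((hasDerivAt_id x).const_sub 1).const_mul 27).fun_mul
        (((hasDerivAt_id x).const_mul 9).const_sub 1))
      refine this.congr_deriv ?_
      simp only [id]
      ring
    have e2 : HasDerivAt (fun x : ℂ => (1 + 3 * x) ^ 4) (4 * (1 + 3 * x) ^ 3 * 3) x := by
      have := (((hasDerivAt_id x).const_mul 3).const_add 1).fun_pow 4
      simpa using this
    refine (e1.fun_div e2 (pow_ne_zero 4 h3)).congr_deriv ?_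
    field_simp
    ring
  refine ⟨fun x => g x * (ρ x * Y (hypArg x) + ζ x * Y₁ (hypArg x)), fun x =>
    g x * (ρ x * (ρ x * Y (hypArg x) + ζ x * Y₁ (hypArg x)) +
      ((-(2 * ν) / (1 - x) ^ 2 + 9 / (1 + 3 * x) ^ 2) * Y (hypArg x) +
        ρ x * (ζ x * Y₁ (hypArg x)) +
        ((27 * (18 * x - 10) * (1 + 3 * x) - 12 * (27 * (1 - x) * (1 - 9 * x)))
          / (1 + 3 * x) ^ 5) * Y₁ (hypArg x) + ζ x * (ζ x * Y₂ (hypArg x)))), ?_⟩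
  filter_upwards [eventually_hypArg_small] with x ⟨h3, h1, hz⟩
  obtain ⟨dY, dY1, ode⟩ := hY _ hz
  have cY : HasDerivAt (fun x => Y (hypArg x)) (ζ x * Y₁ (hypArg x)) x :=
    (dY.comp x (hasDerivAt_hypArg h3)).congr_deriv (mul_comm _ _)
  have cY1 : HasDerivAt (fun x => Y₁ (hypArg x)) (ζ x * Y₂ (hypArg x)) x :=
    (dY1.comp x (hasDerivAt_hypArg h3)).congr_deriv (mul_comm _ _)
  refine ⟨((dg x h3 h1).fun_mul cY).congr_deriv (by ring),
    ((dg x h3 h1).fun_mul (((dρ x h3 h1).fun_mul cY).fun_add ((dζ x h3).fun_mul cY1))).congr_deriv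
      (by ring), ?_⟩
  change _ + odeR ν x * (g x * Y (hypArg x)) = 0
  have ode' : hypArg x * (1 - hypArg x) * Y₂ (hypArg x) + (1 + ν - 2 * hypArg x) * Y₁ (hypArg x) -
      2 / 9 * Y (hypArg x) = 0 := by
    rw [← ode]
    simp only [hYdef]
    ring
  have h3' : 1 + x * 3 ≠ 0 := by rwa [mul_comm x]
  -- The coefficients of `Y₂`, `Y₁` and `Y` are those of Gauss' equation at `hypArg x`, times the
  -- common factor `27 (1 - x) (1 - 9x) / (1 + 3x)²`.
  have c2 : x * odeP x * (ζ x * ζ x) =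
      27 * (1 - x) * (1 - 9 * x) / (1 + 3 * x) ^ 2 * (hypArg x * (1 - hypArg x)) := by
    simp only [odeP, hζ, hypArg]
    field_simp
    ring
  have c1 : x * odeP x * (2 * ρ x * ζ x +
      (27 * (18 * x - 10) * (1 + 3 * x) - 12 * (27 * (1 - x) * (1 - 9 * x))) / (1 + 3 * x) ^ 5) +
      odeQ ν x * ζ x =
      27 * (1 - x) * (1 - 9 * x) / (1 + 3 * x) ^ 2 * (1 + ν - 2 * hypArg x) := by
    simp only [odeP, odeQ, hζ, hρ, hypArg]
    field_simp
    ring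
  have c0 : x * odeP x * (ρ x * ρ x + (-(2 * ν) / (1 - x) ^ 2 + 9 / (1 + 3 * x) ^ 2)) +
      odeQ ν x * ρ x + odeR ν x = -(27 * (1 - x) * (1 - 9 * x) / (1 + 3 * x) ^ 2 * (2 / 9)) := by
    simp only [odeP, odeQ, odeR, hρ]
    field_simp
    ring
  linear_combination (g x * Y₂ (hypArg x)) * c2 + (g x * Y₁ (hypArg x)) * c1 +
    (g x * Y (hypArg x)) * c0 + (g x * (27 * (1 - x) * (1 - 9 * x) / (1 + 3 * x) ^ 2)) * ode'

/-! ### The differential equation of the period integral -/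

noncomputable section

/-- The discriminant `(1 - x(1+s))² - 4x²s`: the product of the extreme values of
`1 - x (1 + s + 2 √s t)` for `|t| ≤ 1`. -/
def stepQuad (x s : ℂ) : ℂ := 1 - 2 * (1 + s) * x + (1 - s) ^ 2 * x ^ 2

/-- The integral of `cos ^ (2 * ν)` over a half period: the total mass of the (unnormalized) law of
a coordinate of a uniform unit step, in the variable `arcsin`. -/
def cosMass (ν : ℕ) : ℝ := ∫ θ in (-(Real.pi / 2))..(Real.pi / 2), Real.cos θ ^ (2 * ν)

/-- The period integral, in the variable `θ` with `s = 2 + 2 sin θ`, that the generating function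
of the moments reduces to. -/
def periodIntegral (ν : ℕ) (x : ℂ) : ℂ :=
  ∫ θ in (-(Real.pi / 2))..(Real.pi / 2),
    ((1 - Complex.sin θ) / 2) ^ ν * stepQuad x (2 + 2 * Complex.sin θ) ^ ((ν : ℂ) - 1 / 2)

/-- The resolvent `∫ cos ^ (2ν) φ / (1 - x (1 + s + 2 √s sin φ)) dφ` of the third step, from a point
at squared distance `s` from the origin. -/
def stepResolvent (ν : ℕ) (x : ℂ) (s : ℝ) : ℂ :=
  ∫ φ in (-(Real.pi / 2))..(Real.pi / 2),
    (Real.cos φ : ℂ) ^ (2 * ν) / (1 - x * (1 + s + 2 * Real.sqrt s * Real.sin φ : ℝ))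

end

lemma stepQuad_mem_slitPlane {x : ℂ} (hx : x ∈ Metric.ball (0 : ℂ) (1 / 20)) {s : ℝ}
    (hs : s ∈ Set.Icc (0 : ℝ) 4) : stepQuad x s ∈ Complex.slitPlane := by
  have hx' : ‖x‖ < 1 / 20 := by simpa using hx
  have h1 : ‖(1 + s : ℂ)‖ ≤ 5 := by
    rw [← Complex.ofReal_one, ← Complex.ofReal_add, Complex.norm_real, Real.norm_eq_abs, abs_le]
    constructor <;> linarith [hs.1, hs.2]
  have h2 : ‖(1 - s : ℂ)‖ ≤ 3 := by
    rw [← Complex.ofReal_one, ← Complex.ofReal_sub, Complex.norm_real, Real.norm_eq_abs, abs_le]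
    constructor <;> linarith [hs.1, hs.2]
  rw [stepQuad, sub_add, sub_eq_add_neg]
  apply Complex.mem_slitPlane_of_norm_lt_one
  rw [norm_neg]
  refine (norm_sub_le _ _).trans_lt ?_
  rw [norm_mul, norm_mul, norm_mul, norm_pow, norm_pow, Complex.norm_ofNat]
  have h3 : ‖(1 - s : ℂ)‖ ^ 2 ≤ 9 := by nlinarith [norm_nonneg (1 - s : ℂ)]
  have h4 : ‖x‖ ^ 2 ≤ 1 / 400 := by nlinarith [norm_nonneg x]
  have h5 : ‖(1 + s : ℂ)‖ * ‖x‖ ≤ 5 * (1 / 20) :=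
    mul_le_mul h1 hx'.le (norm_nonneg _) (by norm_num)
  have h6 : ‖(1 - s : ℂ)‖ ^ 2 * ‖x‖ ^ 2 ≤ 9 * (1 / 400) :=
    mul_le_mul h3 h4 (by positivity) (by norm_num)
  linarith

lemma two_add_two_sin_mem (θ : ℝ) : 2 + 2 * Real.sin θ ∈ Set.Icc (0 : ℝ) 4 :=
  ⟨by linarith [Real.neg_one_le_sin θ], by linarith [Real.sin_le_one θ]⟩

lemma stepQuad_sin_mem_slitPlane {x : ℂ} (hx : x ∈ Metric.ball (0 : ℂ) (1 / 20)) (θ : ℝ) :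
    stepQuad x (2 + 2 * Complex.sin θ) ∈ Complex.slitPlane := by
  have := stepQuad_mem_slitPlane hx (two_add_two_sin_mem θ)
  push_cast at this
  exact this

lemma hasDerivAt_stepQuad (x s : ℂ) :
    HasDerivAt (fun x => stepQuad x s) (-2 * (1 + s) + 2 * (1 - s) ^ 2 * x) x := by
  have := (((hasDerivAt_id x).const_mul (2 * (1 + s))).const_sub 1).fun_add
    (((hasDerivAt_id x).fun_pow 2).const_mul ((1 - s) ^ 2))
  refine this.congr_deriv ?_
  simp
  ring

lemma hasDerivAt_stepQuad_right (x s : ℂ) :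
    HasDerivAt (fun s => stepQuad x s) (-2 * x - 2 * (1 - s) * x ^ 2) s := by
  have := ((((hasDerivAt_id s).const_add 1).const_mul 2).mul_const x).const_sub 1 |>.fun_add
    ((((hasDerivAt_id s).const_sub 1).fun_pow 2).mul_const (x ^ 2))
  refine this.congr_deriv ?_
  simp
  ring

/-- The period integral satisfies the differential equation `x p y'' + q y' + r y = 0`. Applied to
the integrand, the operator gives the `θ`-derivative of
`4μ ((1-u)/2)^ν cos θ (1 + 3x² + u(6x² - 2x)) Q^(μ-1)`, where `u = sin θ`, `μ = ν - 1/2` and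
`Q = stepQuad x (2 + 2u)`; this vanishes at both end points. -/
lemma periodIntegral_ode (ν : ℕ) :
    ∃ f₁ f₂ : ℂ → ℂ, ∀ x ∈ Metric.ball (0 : ℂ) (1 / 20),
      HasDerivAt (periodIntegral ν) (f₁ x) x ∧ HasDerivAt f₁ (f₂ x) x ∧
      x * odeP x * f₂ x + odeQ ν x * f₁ x + odeR ν x * periodIntegral ν x = 0 := by
  set μ : ℂ := (ν : ℂ) - 1 / 2 with hμ
  set w : ℝ → ℂ := fun θ => ((1 - Complex.sin θ) / 2) ^ ν with hw
  set Q : ℂ → ℝ → ℂ := fun x θ => stepQuad x (2 + 2 * Complex.sin θ) with hQ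
  set Q₁ : ℂ → ℝ → ℂ := fun x θ =>
    -2 * (3 + 2 * Complex.sin θ) + 2 * (1 + 2 * Complex.sin θ) ^ 2 * x with hQ₁
  set Q₂ : ℝ → ℂ := fun θ => 2 * (1 + 2 * Complex.sin θ) ^ 2 with hQ₂
  set k₀ : ℂ → ℝ → ℂ := fun x θ => Q x θ ^ μ with hk₀
  set k₁ : ℂ → ℝ → ℂ := fun x θ => μ * Q x θ ^ (μ - 1) * Q₁ x θ with hk₁
  set k₂ : ℂ → ℝ → ℂ := fun x θ =>
    μ * ((μ - 1) * Q x θ ^ (μ - 2) * Q₁ x θ ^ 2 + Q x θ ^ (μ - 1) * Q₂ θ) with hk₂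
  set U := Metric.ball (0 : ℂ) (1 / 20) with hU
  have hwc : Continuous w := by fun_prop
  have hslit : ∀ x ∈ U, ∀ θ, Q x θ ∈ Complex.slitPlane := fun x hx θ =>
    stepQuad_sin_mem_slitPlane hx θ
  have dQ : ∀ x θ, HasDerivAt (fun x => Q x θ) (Q₁ x θ) x := fun x θ =>
    (hasDerivAt_stepQuad x _).congr_deriv (by simp only [hQ₁]; ring)
  have dQ₁ : ∀ x θ, HasDerivAt (fun x => Q₁ x θ) (Q₂ θ) x := fun x θ =>
    (((hasDerivAt_id x).const_mul (Q₂ θ)).const_add _).congr_deriv (mul_one _)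
  have cQ : ∀ e : ℂ, ContinuousOn (fun p : ℂ × ℝ => Q p.1 p.2 ^ e)
      (U ×ˢ Set.uIcc (-(Real.pi / 2)) (Real.pi / 2)) := fun e => by
    refine ContinuousOn.cpow ?_ continuousOn_const fun p hp => hslit _ hp.1 _
    simp only [hQ, stepQuad]
    fun_prop
  have c₀ : ContinuousOn (Function.uncurry k₀)
      (U ×ˢ Set.uIcc (-(Real.pi / 2)) (Real.pi / 2)) := cQ μ
  have c₁ : ContinuousOn (Function.uncurry k₁)
      (U ×ˢ Set.uIcc (-(Real.pi / 2)) (Real.pi / 2)) := by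
    have := cQ (μ - 1)
    simp only [Function.uncurry_def, hk₁, hQ₁]
    fun_prop
  have c₂ : ContinuousOn (Function.uncurry k₂)
      (U ×ˢ Set.uIcc (-(Real.pi / 2)) (Real.pi / 2)) := by
    have h1 := cQ (μ - 1)
    have h2 := cQ (μ - 2)
    simp only [Function.uncurry_def, hk₂, hQ₁, hQ₂]
    fun_prop
  have dk₀ : ∀ x ∈ U, ∀ θ, HasDerivAt (fun x => k₀ x θ) (k₁ x θ) x := fun x hx θ =>
    (dQ x θ).cpow_const (hslit x hx θ)
  have dk₁ : ∀ x ∈ U, ∀ θ, HasDerivAt (fun x => k₁ x θ) (k₂ x θ) x := fun x hx θ => by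
    refine ((((dQ x θ).cpow_const (hslit x hx θ)).const_mul μ).fun_mul (dQ₁ x θ)).congr_deriv ?_
    rw [show μ - 1 - 1 = μ - 2 by ring]
    simp only [hk₂]
    ring
  have hwi := hwc.intervalIntegrable (μ := volume) (-(Real.pi / 2)) (Real.pi / 2)
  have slice : ∀ {f : ℂ → ℝ → ℂ}, ContinuousOn (Function.uncurry f)
      (U ×ˢ Set.uIcc (-(Real.pi / 2)) (Real.pi / 2)) → ∀ x ∈ U,
      IntervalIntegrable (fun θ => w θ * f x θ) volume (-(Real.pi / 2)) (Real.pi / 2) := by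
    intro f hf x hx
    refine hwi.mul_continuousOn ?_
    have : ContinuousOn (fun θ : ℝ => Function.uncurry f (x, θ))
      (Set.uIcc (-(Real.pi / 2)) (Real.pi / 2)) :=
      hf.comp (by fun_prop) (fun θ hθ => ⟨hx, hθ⟩)
    exact this
  refine ⟨fun x => ∫ θ in (-(Real.pi / 2))..(Real.pi / 2), w θ * k₁ x θ,
    fun x => ∫ θ in (-(Real.pi / 2))..(Real.pi / 2), w θ * k₂ x θ, fun x hx => ⟨?_, ?_, ?_⟩⟩
  · exact hasDerivAt_integral_weight_mul Metric.isOpen_ball hwi c₀ c₁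
      (fun x hx θ _ => dk₀ x hx θ) hx
  · exact hasDerivAt_integral_weight_mul Metric.isOpen_ball hwi c₁ c₂
      (fun x hx θ _ => dk₁ x hx θ) hx
  have hF : periodIntegral ν x = ∫ θ in (-(Real.pi / 2))..(Real.pi / 2), w θ * k₀ x θ := rfl
  rw [hF]
  simp only []
  rw [← intervalIntegral.integral_const_mul, ← intervalIntegral.integral_const_mul,
    ← intervalIntegral.integral_const_mul,
    ← intervalIntegral.integral_add ((slice c₂ x hx).const_mul _) ((slice c₁ x hx).const_mul _),
    ← intervalIntegral.integral_add (((slice c₂ x hx).const_mul _).add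
      ((slice c₁ x hx).const_mul _)) ((slice c₀ x hx).const_mul _)]
  -- the function of `θ` whose derivative is the operator applied to the integrand
  set H : ℂ → ℂ := fun θ => 4 * μ * (((1 - Complex.sin θ) / 2) ^ ν * Complex.cos θ *
    (1 + 3 * x ^ 2 + Complex.sin θ * (6 * x ^ 2 - 2 * x)) *
    stepQuad x (2 + 2 * Complex.sin θ) ^ (μ - 1)) with hH
  have dH : ∀ θ : ℝ, HasDerivAt (fun θ : ℝ => H θ)
      (x * odeP x * (w θ * k₂ x θ) + odeQ ν x * (w θ * k₁ x θ) + odeR ν x * (w θ * k₀ x θ)) θ := by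
    intro θ
    have ds := Complex.hasDerivAt_sin (θ : ℂ)
    have dc := Complex.hasDerivAt_cos (θ : ℂ)
    have dw : HasDerivAt (fun θ : ℂ => ((1 - Complex.sin θ) / 2) ^ ν * Complex.cos θ)
        (w θ * (-Complex.sin θ - ν * (1 + Complex.sin θ))) θ := by
      refine ((((ds.const_sub 1).div_const 2).fun_pow ν).fun_mul dc).congr_deriv ?_
      have hcs := Complex.sin_sq_add_cos_sq (θ : ℂ)
      simp only [hw]
      cases ν with
      | zero => simp
      | succ n =>
        rw [Nat.add_sub_cancel, pow_succ]
        push_cast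
        linear_combination (-((1 - Complex.sin θ) / 2) ^ n * (n + 1) / 2) * hcs
    have dQs : HasDerivAt (fun θ : ℂ => stepQuad x (2 + 2 * Complex.sin θ) ^ (μ - 1))
        ((μ - 1) * Q x θ ^ (μ - 2) *
          ((-2 * x + 2 * (1 + 2 * Complex.sin θ) * x ^ 2) * (2 * Complex.cos θ))) θ := by
      have h1 : HasDerivAt (fun θ : ℂ => stepQuad x (2 + 2 * Complex.sin θ))
          ((-2 * x + 2 * (1 + 2 * Complex.sin θ) * x ^ 2) * (2 * Complex.cos θ)) θ :=
        (HasDerivAt.comp (h₂ := fun s => stepQuad x s) (θ : ℂ)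
          (hasDerivAt_stepQuad_right x (2 + 2 * Complex.sin θ))
          ((ds.const_mul 2).const_add 2)).congr_deriv (by ring)
      refine (h1.cpow_const (hslit x hx θ)).congr_deriv ?_
      rw [show μ - 1 - 1 = μ - 2 by ring]
    have dR : HasDerivAt
        (fun θ : ℂ => 1 + 3 * x ^ 2 + Complex.sin θ * (6 * x ^ 2 - 2 * x))
        (Complex.cos θ * (6 * x ^ 2 - 2 * x)) θ :=
      (ds.mul_const _).const_add _
    refine (((dw.fun_mul dR).fun_mul dQs).const_mul (4 * μ)).comp_ofReal.congr_deriv ?_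
    have hQ0 : Q x θ ≠ 0 := Complex.slitPlane_ne_zero (hslit x hx θ)
    have e1 : Q x θ ^ (μ - 1) = Q x θ ^ (μ - 2) * Q x θ := by
      nth_rewrite 3 [← Complex.cpow_one (Q x θ)]
      rw [← Complex.cpow_add _ _ hQ0]
      congr 1
      ring
    have e0 : Q x θ ^ μ = Q x θ ^ (μ - 2) * Q x θ ^ 2 := by
      rw [show μ = μ - 2 + (2 : ℕ) by push_cast; ring, Complex.cpow_add _ _ hQ0,
        Complex.cpow_natCast]
      congr 2
      push_cast
      ring
    have e1' : stepQuad x (2 + 2 * Complex.sin θ) ^ (μ - 1) = Q x θ ^ (μ - 2) * Q x θ := e1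
    simp only [hk₂, hk₁, hk₀, e0, e1, e1']
    have hν : (ν : ℂ) = μ + 1 / 2 := by rw [hμ]; ring
    rw [hν]
    have hc2 : Complex.cos θ * Complex.cos θ = 1 - Complex.sin θ ^ 2 := by
      linear_combination Complex.sin_sq_add_cos_sq (θ : ℂ)
    have hw0 : ((1 - Complex.sin θ) / 2) ^ ν = w θ := rfl
    rw [hw0]
    generalize Q x θ ^ (μ - 2) = q
    generalize w θ = W
    simp only [hQ, hQ₁, hQ₂, stepQuad, odeP, odeQ, odeR]
    generalize Complex.sin (θ : ℂ) = u at hc2 ⊢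
    generalize Complex.cos (θ : ℂ) = v at hc2 ⊢
    clear_value μ
    clear hH
    linear_combination (4 * μ * W * q * ((6 * x ^ 2 - 2 * x) *
      (1 - 2 * (1 + (2 + 2 * u)) * x + (1 - (2 + 2 * u)) ^ 2 * x ^ 2) +
      (1 + 3 * x ^ 2 + u * (6 * x ^ 2 - 2 * x)) * (μ - 1) *
        (2 * (-2 * x + 2 * (1 + 2 * u) * x ^ 2)))) * hc2
  rw [intervalIntegral.integral_eq_sub_of_hasDerivAt (f := fun θ : ℝ => H θ) (fun θ _ => dH θ)]
  · have hc : Complex.cos ((Real.pi / 2 : ℝ) : ℂ) = 0 := by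
      rw [← Complex.ofReal_cos, Real.cos_pi_div_two, Complex.ofReal_zero]
    simp only [hH, Complex.ofReal_neg, Complex.cos_neg, hc]
    ring
  · exact (((slice c₂ x hx).const_mul _).add ((slice c₁ x hx).const_mul _)).add
      ((slice c₀ x hx).const_mul _)

/-! ### The period integral near the origin and the resolvent of one step -/

lemma cosMass_zero : cosMass 0 = Real.pi := by
  simp [cosMass]

lemma cosMass_succ (ν : ℕ) : (2 * ν + 2) * cosMass (ν + 1) = (2 * ν + 1) * cosMass ν := by
  simp only [cosMass, mul_add, mul_one, integral_cos_pow]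
  simp
  field_simp

lemma cosMass_eq (ν : ℕ) : cosMass ν = Real.pi * (2 * ν).choose ν / 4 ^ ν := by
  rw [← Nat.centralBinom_eq_two_mul_choose]
  induction ν with
  | zero => simp [cosMass_zero]
  | succ n ih =>
    have h := cosMass_succ n
    have h2 : ((n + 1 : ℕ) : ℝ) * (n + 1).centralBinom = 2 * (2 * n + 1) * n.centralBinom := by
      exact_mod_cast Nat.succ_mul_centralBinom_succ n
    have h3 : (n + 1 : ℝ) ≠ 0 := by positivity
    rw [ih] at h
    rw [pow_succ]
    push_cast at h2
    field_simp at h ⊢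
    apply mul_left_cancel₀ h3
    linear_combination 2 * h - Real.pi * h2

lemma cosMass_pos (ν : ℕ) : 0 < cosMass ν := by
  rw [cosMass_eq]
  have : 0 < (2 * ν).choose ν := Nat.choose_pos (by omega)
  positivity

/-- At `x = 0` the integrand is `((1 - sin θ) / 2) ^ ν`; integration by parts gives its integral the
recurrence `cosMass_succ`. -/
lemma periodIntegral_zero (ν : ℕ) : periodIntegral ν 0 = cosMass ν := by
  have h0 : ∀ n : ℕ, ∫ θ in (-(Real.pi / 2))..(Real.pi / 2), ((1 - Real.sin θ) / 2) ^ n =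
      cosMass n := by
    intro n
    induction n with
    | zero => simp [cosMass_zero]
    | succ n ih =>
      have hd : ∀ θ : ℝ, HasDerivAt (fun θ => ((1 - Real.sin θ) / 2) ^ n * Real.cos θ)
          ((2 * n + 2) * ((1 - Real.sin θ) / 2) ^ (n + 1) -
            (2 * n + 1) * ((1 - Real.sin θ) / 2) ^ n) θ := by
        intro θ
        refine (((((Real.hasDerivAt_sin θ).const_sub 1).div_const 2).fun_pow n).fun_mul
          (Real.hasDerivAt_cos θ)).congr_deriv ?_
        have hcs := Real.sin_sq_add_cos_sq θ
        cases n with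
        | zero => simp; ring
        | succ m =>
          rw [Nat.add_sub_cancel, pow_succ, pow_succ]
          push_cast
          linear_combination (-((1 - Real.sin θ) / 2) ^ m * (m + 1) / 2) * hcs
      have hint := intervalIntegral.integral_eq_sub_of_hasDerivAt
        (a := -(Real.pi / 2)) (b := Real.pi / 2) (fun θ _ => hd θ)
        (Continuous.intervalIntegrable (by fun_prop) _ _)
      rw [intervalIntegral.integral_sub (Continuous.intervalIntegrable (by fun_prop) _ _)
        (Continuous.intervalIntegrable (by fun_prop) _ _),
        intervalIntegral.integral_const_mul, intervalIntegral.integral_const_mul, ih,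
        ← cosMass_succ, Real.cos_neg, Real.cos_pi_div_two, mul_zero, mul_zero, sub_zero,
        ← mul_sub] at hint
      have h2 : (2 * n + 2 : ℝ) ≠ 0 := by positivity
      exact sub_eq_zero.1 ((mul_eq_zero.1 hint).resolve_left h2)
  rw [← h0 ν, ← intervalIntegral.integral_ofReal]
  simp [periodIntegral, stepQuad]

/-- Near `0` the period integral is a multiple of the hypergeometric function: both are analytic
solutions of one differential equation with a regular singular point. -/
lemma periodIntegral_eventually_eq (ν : ℕ) :
    ∀ᶠ x in 𝓝 (0 : ℂ), periodIntegral ν x = cosMass ν * hypRegular ν x := by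
  obtain ⟨F₁, F₂, hF⟩ := periodIntegral_ode ν
  obtain ⟨f₁, f₂, hf⟩ := hypRegular_ode ν
  have hball : ∀ᶠ x in 𝓝 (0 : ℂ), x ∈ Metric.ball (0 : ℂ) (1 / 20) :=
    Metric.ball_mem_nhds _ (by norm_num)
  have key := eventually_eq_zero_of_regular_singular_ode
    (D := fun x => periodIntegral ν x - cosMass ν * hypRegular ν x)
    (D₁ := fun x => F₁ x - cosMass ν * f₁ x) (D₂ := fun x => F₂ x - cosMass ν * f₂ x)
    (p := odeP) (q := odeQ ν) (r := odeR ν) ?_ ?_ ?_ ?_ ?_ ?_ ?_ ?_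
  · exact key.mono fun x hx => sub_eq_zero.1 hx
  · filter_upwards [hball, hf] with x h1 h2
    exact (hF x h1).1.fun_sub (h2.1.const_mul _)
  · filter_upwards [hball, hf] with x h1 h2
    exact (hF x h1).2.1.fun_sub (h2.2.1.const_mul _)
  · unfold odeP; fun_prop
  · unfold odeQ; fun_prop
  · unfold odeR; fun_prop
  · intro m h
    simp only [odeP, odeQ] at h
    norm_num at h
    have : ((m + 1 + ν : ℕ) : ℂ) = 0 := by push_cast; linear_combination h
    have := Nat.cast_eq_zero.1 this
    omega
  · filter_upwards [hball, hf] with x h1 h2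
    linear_combination (hF x h1).2.2 - cosMass ν * h2.2.2
  · simp [periodIntegral_zero, hypRegular, hypArg]

/-- The squared distance after a unit step in a direction of elevation `φ` from squared distance
`s` lies between `0` and `9` if `s ≤ 4`. -/
lemma step_sq_mem {s : ℝ} (hs : s ∈ Set.Icc (0 : ℝ) 4) (φ : ℝ) :
    1 + s + 2 * Real.sqrt s * Real.sin φ ∈ Set.Icc (0 : ℝ) 9 := by
  have h1 := Real.sq_sqrt hs.1
  have h2 := Real.sqrt_nonneg s
  have h3 : Real.sqrt s ≤ 2 := Real.sqrt_le_iff.2 ⟨by norm_num, by linarith [hs.2]⟩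
  have h4 := Real.sin_le_one φ
  have h5 := Real.neg_one_le_sin φ
  constructor <;> nlinarith [mul_nonneg h2 (sub_nonneg.2 h4), sq_nonneg (Real.sqrt s - 1),
    mul_nonneg h2 (show 0 ≤ Real.sin φ + 1 by linarith)]

lemma one_sub_mul_step_ne_zero {x : ℂ} (hx : ‖x‖ < 1 / 9) {e : ℝ} (he : e ∈ Set.Icc (0 : ℝ) 9) :
    1 - x * e ≠ 0 := by
  intro h
  have h1 : ‖x * e‖ = 1 := by rw [← sub_eq_zero.1 h, norm_one]
  rw [norm_mul, Complex.norm_real, Real.norm_eq_abs, abs_of_nonneg he.1] at h1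
  nlinarith [norm_nonneg x, he.1, he.2]

/-- The resolvent in the plane (`ν = 0`). The product of the integral with `√Q` has derivative zero
in `x`, since the derivative of its integrand is a multiple of a `φ`-derivative. -/
lemma stepResolvent_zero {x : ℂ} (hx : x ∈ Metric.ball (0 : ℂ) (1 / 20)) {s : ℝ}
    (hs : s ∈ Set.Icc (0 : ℝ) 4) :
    stepResolvent 0 x s = Real.pi * stepQuad x s ^ (-(1 / 2) : ℂ) := by
  set U := Metric.ball (0 : ℂ) (1 / 20) with hU
  set E : ℝ → ℝ := fun φ => 1 + s + 2 * Real.sqrt s * Real.sin φ with hE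
  have hne : ∀ x ∈ U, ∀ φ, 1 - x * (E φ : ℂ) ≠ 0 := fun x hx φ =>
    one_sub_mul_step_ne_zero (lt_trans (by simpa [hU] using hx) (by norm_num)) (step_sq_mem hs φ)
  have hEc : Continuous E := by fun_prop
  have dk : ∀ x ∈ U, ∀ φ, HasDerivAt (fun x : ℂ => (1 - x * (E φ : ℂ))⁻¹)
      (E φ / (1 - x * (E φ : ℂ)) ^ 2) x := fun x hx φ => by
    have h1 : HasDerivAt (fun x : ℂ => 1 - x * (E φ : ℂ)) (-(E φ : ℂ)) x := by
      simpa using ((hasDerivAt_id x).mul_const (E φ : ℂ)).const_sub 1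
    simpa using h1.fun_inv (hne x hx φ)
  have dG : ∀ x ∈ U, HasDerivAt (fun x => stepResolvent 0 x s)
      (∫ φ in (-(Real.pi / 2))..(Real.pi / 2), (E φ / (1 - x * (E φ : ℂ)) ^ 2 : ℂ)) x := by
    intro x hx
    have := hasDerivAt_integral_weight_mul Metric.isOpen_ball (a := -(Real.pi / 2))
      (b := Real.pi / 2) (w := fun _ => 1) (k := fun x φ => (1 - x * (E φ : ℂ))⁻¹)
      (k' := fun x φ => E φ / (1 - x * (E φ : ℂ)) ^ 2) (by simp) ?_ ?_
      (fun x hx φ _ => dk x hx φ) hx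
    · simpa [stepResolvent, hE] using this
    · exact ContinuousOn.inv₀ (by fun_prop) fun p hp => hne _ hp.1 _
    · exact ContinuousOn.div (by fun_prop) (by fun_prop) fun p hp =>
        pow_ne_zero 2 (hne _ hp.1 _)
  have hcont : ∀ x ∈ U, Continuous fun φ => (E φ / (1 - x * (E φ : ℂ)) ^ 2 : ℂ) := fun x hx =>
    Continuous.div (by fun_prop) (by fun_prop) fun φ => pow_ne_zero 2 (hne x hx φ)
  have hcont' : ∀ x ∈ U, Continuous fun φ => (1 - x * (E φ : ℂ))⁻¹ := fun x hx =>
    Continuous.inv₀ (by fun_prop) fun φ => hne x hx φ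
  have hrs : ((Real.sqrt s : ℝ) : ℂ) ^ 2 = s := by exact_mod_cast Real.sq_sqrt hs.1
  have hzero : ∀ x ∈ U, stepQuad x s *
      (∫ φ in (-(Real.pi / 2))..(Real.pi / 2), (E φ / (1 - x * (E φ : ℂ)) ^ 2 : ℂ)) +
      1 / 2 * (-2 * (1 + s) + 2 * (1 - s) ^ 2 * x) * stepResolvent 0 x s = 0 := by
    intro x hx
    have e : stepResolvent 0 x s =
        ∫ φ in (-(Real.pi / 2))..(Real.pi / 2), (1 - x * (E φ : ℂ))⁻¹ := by
      simp [stepResolvent, hE]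
    rw [e, ← intervalIntegral.integral_const_mul, ← intervalIntegral.integral_const_mul,
      ← intervalIntegral.integral_add (((hcont x hx).const_mul _).intervalIntegrable _ _)
      (((hcont' x hx).const_mul _).intervalIntegrable _ _)]
    have dH : ∀ φ : ℝ, HasDerivAt
        (fun φ : ℝ => (-2 * Real.sqrt s * Real.cos φ : ℂ) / (1 - x * (E φ : ℂ)))
        (stepQuad x s * (E φ / (1 - x * (E φ : ℂ)) ^ 2) +
          1 / 2 * (-2 * (1 + s) + 2 * (1 - s) ^ 2 * x) * (1 - x * (E φ : ℂ))⁻¹) φ := by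
      intro φ
      have h1 : HasDerivAt (fun φ : ℝ => (-2 * Real.sqrt s * Real.cos φ : ℂ))
          (-2 * Real.sqrt s * (-Real.sin φ : ℝ)) φ :=
        ((Real.hasDerivAt_cos φ).ofReal_comp).const_mul _
      have h2 : HasDerivAt (fun φ : ℝ => 1 - x * (E φ : ℂ))
          (-(x * (2 * Real.sqrt s * Real.cos φ : ℝ))) φ :=
        (((((Real.hasDerivAt_sin φ).const_mul (2 * Real.sqrt s)).const_add
          (1 + s)).ofReal_comp).const_mul x).const_sub 1
      refine (h1.fun_div h2 (hne x hx φ)).congr_deriv ?_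
      have h0 := hne x hx φ
      have hcs : (Real.cos φ : ℂ) ^ 2 = 1 - (Real.sin φ : ℂ) ^ 2 := by
        exact_mod_cast Real.cos_sq' φ
      rw [div_eq_iff (pow_ne_zero 2 h0), add_mul, mul_assoc (stepQuad x s),
        div_mul_cancel₀ _ (pow_ne_zero 2 h0), mul_assoc _ (_⁻¹), pow_two (1 - x * (E φ : ℂ)),
        inv_mul_cancel_left₀ h0]
      simp only [hE, stepQuad]
      push_cast at hcs ⊢
      generalize (Real.sqrt s : ℂ) = r at hrs
      rw [← hrs]
      linear_combination (-4 * r ^ 2 * x) * hcs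
    rw [intervalIntegral.integral_eq_sub_of_hasDerivAt (fun φ _ => dH φ)]
    · simp
    · exact (((hcont x hx).const_mul _).add ((hcont' x hx).const_mul _)).intervalIntegrable _ _
  have hslit : ∀ x ∈ U, stepQuad x s ∈ Complex.slitPlane := fun x hx =>
    stepQuad_mem_slitPlane hx hs
  have dh : ∀ x ∈ U,
      HasDerivAt (fun x => stepResolvent 0 x s * stepQuad x s ^ (1 / 2 : ℂ)) 0 x := by
    intro x hx
    have hQ0 := Complex.slitPlane_ne_zero (hslit x hx)
    refine ((dG x hx).fun_mul ((hasDerivAt_stepQuad x s).cpow_const (hslit x hx))).congr_deriv ?_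
    have e1 : stepQuad x s ^ (1 / 2 : ℂ) = stepQuad x s ^ (1 / 2 - 1 : ℂ) * stepQuad x s := by
      nth_rewrite 3 [← Complex.cpow_one (stepQuad x s)]
      rw [← Complex.cpow_add _ _ hQ0]
      congr 1
      ring
    rw [e1]
    linear_combination (stepQuad x s ^ (1 / 2 - 1 : ℂ)) * hzero x hx
  have h0U : (0 : ℂ) ∈ U := by simp [hU]
  have hconst := Metric.isOpen_ball.is_const_of_deriv_eq_zero
    (convex_ball (0 : ℂ) (1 / 20)).isPreconnected
    (fun x hx => (dh x hx).differentiableAt.differentiableWithinAt)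
    (fun x hx => (dh x hx).deriv) hx h0U
  simp only [stepQuad, mul_zero, sub_zero, zero_pow two_ne_zero, add_zero, Complex.one_cpow,
    mul_one] at hconst
  have h0 : stepResolvent 0 0 s = Real.pi := by
    simp [stepResolvent]
  have hQ0 := Complex.slitPlane_ne_zero (hslit x hx)
  have hpw : stepQuad x s ^ (1 / 2 : ℂ) * stepQuad x s ^ (-(1 / 2) : ℂ) = 1 := by
    rw [← Complex.cpow_add _ _ hQ0]; simp
  change stepResolvent 0 x s * stepQuad x s ^ (1 / 2 : ℂ) = _ at hconst
  rw [h0] at hconst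
  linear_combination stepQuad x s ^ (-(1 / 2) : ℂ) * hconst - stepResolvent 0 x s * hpw

lemma integral_cos_pow_mul_sin (ν : ℕ) :
    ∫ φ in (-(Real.pi / 2))..(Real.pi / 2), Real.cos φ ^ (2 * ν) * Real.sin φ = 0 := by
  have h := intervalIntegral.integral_comp_neg (a := -(Real.pi / 2)) (b := Real.pi / 2)
    (fun φ => Real.cos φ ^ (2 * ν) * Real.sin φ)
  simp only [Real.cos_neg, Real.sin_neg, mul_neg, intervalIntegral.integral_neg, neg_neg] at h
  linarith

/-- Raising the dimension by two, because
`4x²s (1 - t²) = (A - 2x√s t)(A + 2x√s t) - Q` with `A = 1 - x (1 + s)`. -/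
lemma stepResolvent_succ (ν : ℕ) {x : ℂ} (hx : ‖x‖ < 1 / 9) {s : ℝ}
    (hs : s ∈ Set.Icc (0 : ℝ) 4) :
    4 * x ^ 2 * s * stepResolvent (ν + 1) x s =
      -stepQuad x s * stepResolvent ν x s + (1 - x * (1 + s)) * cosMass ν := by
  set E : ℝ → ℝ := fun φ => 1 + s + 2 * Real.sqrt s * Real.sin φ with hE
  have hne : ∀ φ, 1 - x * (E φ : ℂ) ≠ 0 := fun φ =>
    one_sub_mul_step_ne_zero hx (step_sq_mem hs φ)
  have hrs : ((Real.sqrt s : ℝ) : ℂ) ^ 2 = s := by exact_mod_cast Real.sq_sqrt hs.1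
  have hcont : Continuous fun φ => (Real.cos φ : ℂ) ^ (2 * ν) / (1 - x * (E φ : ℂ)) :=
    Continuous.div (by fun_prop) (by fun_prop) hne
  have hB : (cosMass ν : ℂ) =
      ∫ φ in (-(Real.pi / 2))..(Real.pi / 2), (Real.cos φ : ℂ) ^ (2 * ν) := by
    rw [cosMass, ← intervalIntegral.integral_ofReal]
    simp
  have hS : (0 : ℂ) =
      ∫ φ in (-(Real.pi / 2))..(Real.pi / 2), (Real.cos φ : ℂ) ^ (2 * ν) * Real.sin φ := by
    rw [← Complex.ofReal_zero, ← integral_cos_pow_mul_sin ν, ← intervalIntegral.integral_ofReal]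
    simp
  have hS' : (1 - x * (1 + s)) * (cosMass ν : ℂ) = (1 - x * (1 + s)) * (cosMass ν : ℂ) +
    2 * x * Real.sqrt s * 0 := by ring
  rw [hS', hS, hB]
  simp only [stepResolvent]
  rw [← intervalIntegral.integral_const_mul, ← intervalIntegral.integral_const_mul,
    ← intervalIntegral.integral_const_mul, ← intervalIntegral.integral_const_mul,
    ← intervalIntegral.integral_add (Continuous.intervalIntegrable (by fun_prop) _ _)
      (Continuous.intervalIntegrable (by fun_prop) _ _),
    ← intervalIntegral.integral_add ((hcont.const_mul _).intervalIntegrable _ _)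
      (Continuous.intervalIntegrable (by fun_prop) _ _)]
  refine intervalIntegral.integral_congr fun φ _ => ?_
  have h0 := hne φ
  have hcs : (Real.cos φ : ℂ) ^ 2 = 1 - (Real.sin φ : ℂ) ^ 2 := by
    exact_mod_cast Real.cos_sq' φ
  have hi := mul_inv_cancel₀ h0
  simp only [mul_add, mul_one, pow_add, div_eq_mul_inv]
  rw [hcs]
  generalize (1 - x * (E φ : ℂ))⁻¹ = i at hi ⊢
  simp only [hE] at hi
  push_cast at hi ⊢
  generalize (Real.sqrt s : ℂ) = r at hrs hi ⊢
  rw [← hrs] at hi ⊢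
  simp only [stepQuad]
  linear_combination (1 - x * (1 + r ^ 2) + 2 * x * r * Complex.sin φ) *
    Complex.cos φ ^ (2 * ν) * hi

/-! ### The resolvent of the walk as a period integral -/

noncomputable section

/-- The resolvent `E[1 / (1 - x R²)]` of the squared distance after three steps, up to the factor
`(cosMass ν)²`, as an iterated integral over the angles of the second and the third step. -/
def walkResolvent (ν : ℕ) (x : ℂ) : ℂ :=
  ∫ θ in (-(Real.pi / 2))..(Real.pi / 2),
    (Real.cos θ : ℂ) ^ (2 * ν) * stepResolvent ν x (2 + 2 * Real.sin θ)

end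

/-- Up to a polynomial of degree less than `2ν` in `x`, the resolvent of a step is a half-integer
power of `stepQuad`. -/
lemma exists_stepResolvent_eq (ν : ℕ) :
    ∃ P : Polynomial (Polynomial ℂ), (∀ i, 2 * ν ≤ i → P.coeff i = 0) ∧
      ∀ x ∈ Metric.ball (0 : ℂ) (1 / 20), ∀ s ∈ Set.Icc (0 : ℝ) 4,
        (4 * x ^ 2 * s) ^ ν * stepResolvent ν x s =
          Real.pi * (-1) ^ ν * stepQuad x s ^ ((ν : ℂ) - 1 / 2) +
            P.eval₂ (Polynomial.evalRingHom (s : ℂ)) x := by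
  induction ν with
  | zero =>
    refine ⟨0, by simp, fun x hx s hs => ?_⟩
    rw [stepResolvent_zero hx hs]
    simp
  | succ ν ih =>
    obtain ⟨P, hP, h⟩ := ih
    -- the outer variable is `x`, the coefficients are polynomials in `s`
    open Polynomial in
    refine ⟨-P + C (C 2 * (1 + X)) * P * X - C ((1 - X) ^ 2) * P * X ^ 2
      + C (C ((4 : ℂ) ^ ν * cosMass ν) * X ^ ν) * X ^ (2 * ν)
      - C (C ((4 : ℂ) ^ ν * cosMass ν) * X ^ ν * (1 + X)) * X ^ (2 * ν + 1), ?_, ?_⟩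
    · intro i hi
      have e1 : ∀ R : Polynomial (Polynomial ℂ), (R * X).coeff i = R.coeff (i - 1) := fun R => by
        obtain ⟨j, rfl⟩ : ∃ j, i = j + 1 := ⟨i - 1, by omega⟩
        rw [Polynomial.coeff_mul_X, Nat.add_sub_cancel]
      have e2 : ∀ R : Polynomial (Polynomial ℂ), (R * X ^ 2).coeff i = R.coeff (i - 2) :=
        fun R => by
        rw [Polynomial.coeff_mul_X_pow', if_pos (by omega)]
      rw [Polynomial.coeff_sub, Polynomial.coeff_add, Polynomial.coeff_sub, Polynomial.coeff_add,
        Polynomial.coeff_neg, e1, e2, Polynomial.coeff_C_mul, Polynomial.coeff_C_mul,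
        Polynomial.coeff_C_mul_X_pow, Polynomial.coeff_C_mul_X_pow, hP i (by omega),
        hP (i - 1) (by omega), hP (i - 2) (by omega), if_neg (by omega), if_neg (by omega)]
      simp
    · intro x hx s hs
      have hx9 : ‖x‖ < 1 / 9 := lt_trans (by simpa using hx) (by norm_num)
      have hr := stepResolvent_succ ν hx9 hs
      have hQ0 := Complex.slitPlane_ne_zero (stepQuad_mem_slitPlane hx hs)
      have hpw : stepQuad x s ^ (((ν + 1 : ℕ) : ℂ) - 1 / 2) =
          stepQuad x s ^ ((ν : ℂ) - 1 / 2) * stepQuad x s := by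
        nth_rewrite 3 [← Complex.cpow_one (stepQuad x s)]
        rw [← Complex.cpow_add _ _ hQ0]
        congr 1
        push_cast
        ring
      have hh := h x hx s hs
      rw [hpw]
      simp only [Polynomial.eval₂_add, Polynomial.eval₂_sub, Polynomial.eval₂_neg,
        Polynomial.eval₂_mul, Polynomial.eval₂_C, Polynomial.eval₂_X, Polynomial.eval₂_pow,
        Polynomial.eval₂_one,
        map_mul, map_add, map_sub, map_pow, map_one, Polynomial.coe_evalRingHom,
        Polynomial.eval_C, Polynomial.eval_X]
      have e4 : (4 * x ^ 2 * (s : ℂ)) ^ ν = 4 ^ ν * (s : ℂ) ^ ν * x ^ (2 * ν) := by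
        rw [mul_pow, mul_pow, ← pow_mul]; ring
      have hQ : stepQuad x s = 1 - 2 * (1 + s) * x + (1 - s) ^ 2 * x ^ 2 := rfl
      rw [pow_succ, mul_assoc, hr, pow_succ (-1 : ℂ)]
      have hh' := congrArg (fun t => -stepQuad x s * t) hh
      generalize stepQuad x s ^ ((ν : ℂ) - 1 / 2) = q at *
      rw [e4] at *
      rw [hQ] at *
      linear_combination hh'

/-- Up to a polynomial of degree less than `2ν` in `x`, the resolvent of the walk is the period
integral. The weight `cos ^ (2ν) θ = ((1 - sin θ) / 2) ^ ν s ^ ν` cancels the powers of `s`. -/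
lemma exists_walkResolvent_eq (ν : ℕ) :
    ∃ b : ℕ → ℂ, ∀ x ∈ Metric.ball (0 : ℂ) (1 / 20),
      (4 * x ^ 2) ^ ν * walkResolvent ν x = Real.pi * (-1) ^ ν * periodIntegral ν x +
        ∑ i ∈ Finset.range (2 * ν), b i * x ^ i := by
  obtain ⟨P, hP, h⟩ := exists_stepResolvent_eq ν
  set w : ℝ → ℂ := fun θ => ((1 - Complex.sin θ) / 2) ^ ν with hw
  refine ⟨fun i => ∫ θ in (-(Real.pi / 2))..(Real.pi / 2),
    w θ * (P.coeff i).eval (2 + 2 * Complex.sin θ), fun x hx => ?_⟩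
  have hev : ∀ s : ℂ, P.eval₂ (Polynomial.evalRingHom s) x =
      ∑ i ∈ Finset.range (2 * ν), (P.coeff i).eval s * x ^ i := by
    intro s
    have hdeg : P.natDegree < 2 * ν + 1 := Nat.lt_succ_of_le
      (Polynomial.natDegree_le_iff_coeff_eq_zero.2 fun N hN => hP N hN.le)
    rw [Polynomial.eval₂_eq_sum_range' _ hdeg, Finset.sum_range_succ, hP _ le_rfl]
    simp
  have cw : Continuous w := by fun_prop
  have cQ : Continuous fun θ : ℝ =>
      stepQuad x (2 + 2 * Complex.sin θ) ^ ((ν : ℂ) - 1 / 2) := by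
    refine Continuous.cpow ?_ continuous_const fun θ => stepQuad_sin_mem_slitPlane hx θ
    simp only [stepQuad]
    fun_prop
  have cP : ∀ i, Continuous fun θ : ℝ => w θ * (P.coeff i).eval (2 + 2 * Complex.sin θ) :=
    fun i => cw.mul ((P.coeff i).continuous.comp (by fun_prop))
  have cPx : ∀ i, Continuous fun θ : ℝ =>
      w θ * (P.coeff i).eval (2 + 2 * Complex.sin θ) * x ^ i := fun i => (cP i).mul continuous_const
  have cwQ : Continuous fun θ : ℝ => ((Real.pi : ℂ) * (-1) ^ ν) *
      (w θ * stepQuad x (2 + 2 * Complex.sin θ) ^ ((ν : ℂ) - 1 / 2)) :=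
    continuous_const.mul (cw.mul cQ)
  rw [walkResolvent, periodIntegral, ← intervalIntegral.integral_const_mul,
    ← intervalIntegral.integral_const_mul]
  simp_rw [← intervalIntegral.integral_mul_const]
  rw [← intervalIntegral.integral_finsetSum
      (fun i _ => (cPx i).intervalIntegrable _ _),
    ← intervalIntegral.integral_add (cwQ.intervalIntegrable _ _)
      ((continuous_finsetSum _ fun i _ => cPx i).intervalIntegrable _ _)]
  refine intervalIntegral.integral_congr fun θ _ => ?_
  have hs := h x hx _ (two_add_two_sin_mem θ)
  rw [hev] at hs
  push_cast at hs ⊢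
  have hcos : Complex.cos (θ : ℂ) ^ (2 * ν) = w θ * (2 + 2 * Complex.sin θ) ^ ν := by
    simp only [hw]
    rw [pow_mul, ← mul_pow]
    congr 1
    linear_combination Complex.sin_sq_add_cos_sq (θ : ℂ)
  rw [hcos]
  rw [mul_pow] at hs
  simp_rw [mul_assoc (w θ)]
  rw [← Finset.mul_sum]
  linear_combination (w θ) * hs

/-! ### Coordinates of a uniform point on the sphere -/

/-- Half-line Gaussian moments. -/
lemma integral_Ioi_pow_mul_exp_neg_sq (k : ℕ) :
    ∫ r in Set.Ioi (0 : ℝ), r ^ k * Real.exp (-r ^ 2) = 1 / 2 * Real.Gamma ((k + 1) / 2) := by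
  have h := integral_rpow_mul_exp_neg_rpow (p := 2) (q := k) two_pos
    (by have : (0 : ℝ) ≤ k := k.cast_nonneg
        linarith)
  rw [← h]
  refine setIntegral_congr_fun measurableSet_Ioi fun r _ => ?_
  simp only [Real.rpow_natCast, ← Real.rpow_natCast r 2, Nat.cast_ofNat]

lemma integral_Ioi_pow_mul_exp_neg_sq_add_two (k : ℕ) :
    ∫ r in Set.Ioi (0 : ℝ), r ^ (k + 2) * Real.exp (-r ^ 2) =
      (k + 1) / 2 * ∫ r in Set.Ioi (0 : ℝ), r ^ k * Real.exp (-r ^ 2) := by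
  rw [integral_Ioi_pow_mul_exp_neg_sq, integral_Ioi_pow_mul_exp_neg_sq]
  have h : ((k + 2 : ℕ) + 1 : ℝ) / 2 = (k + 1) / 2 + 1 := by push_cast; ring
  rw [h, Real.Gamma_add_one (by positivity)]
  ring

lemma integral_Ioi_pow_mul_exp_neg_sq_pos (k : ℕ) :
    0 < ∫ r in Set.Ioi (0 : ℝ), r ^ k * Real.exp (-r ^ 2) := by
  rw [integral_Ioi_pow_mul_exp_neg_sq]
  have := Real.Gamma_pos_of_pos (s := (k + 1) / 2) (by positivity)
  positivity

lemma integral_pow_mul_exp_neg_sq_of_odd {k : ℕ} (hk : Odd k) :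
    ∫ t : ℝ, t ^ k * Real.exp (-t ^ 2) = 0 := by
  have h := integral_neg_eq_self (fun t : ℝ => t ^ k * Real.exp (-t ^ 2)) volume
  simp only [hk.neg_pow, even_two.neg_pow, neg_mul, integral_neg] at h
  linarith

lemma integral_pow_mul_exp_neg_sq_of_even {k : ℕ} (hk : Even k) :
    ∫ t : ℝ, t ^ k * Real.exp (-t ^ 2) =
      2 * ∫ r in Set.Ioi (0 : ℝ), r ^ k * Real.exp (-r ^ 2) := by
  rw [← integral_comp_abs (f := fun t : ℝ => t ^ k * Real.exp (-t ^ 2))]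
  simp only [hk.pow_abs, sq_abs]

lemma integral_pow_mul_exp_neg_sq_add_two (k : ℕ) :
    ∫ t : ℝ, t ^ (k + 2) * Real.exp (-t ^ 2) =
      (k + 1) / 2 * ∫ t : ℝ, t ^ k * Real.exp (-t ^ 2) := by
  rcases Nat.even_or_odd k with hk | hk
  · rw [integral_pow_mul_exp_neg_sq_of_even hk,
      integral_pow_mul_exp_neg_sq_of_even (hk.add even_two),
      integral_Ioi_pow_mul_exp_neg_sq_add_two]
    ring
  · rw [integral_pow_mul_exp_neg_sq_of_odd hk,
      integral_pow_mul_exp_neg_sq_of_odd (hk.add_even even_two), mul_zero]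

/-- Polar coordinates for a homogeneous function against the Gaussian weight. -/
lemma integral_homogeneous_mul_exp_neg_sq {E : Type*} [NormedAddCommGroup E] [NormedSpace ℝ E]
    [MeasurableSpace E] [BorelSpace E] [FiniteDimensional ℝ E] [Nontrivial E] (μ : Measure E)
    [μ.IsAddHaarMeasure] (m : ℕ) (f : E → ℝ) (hf : ∀ (r : ℝ) (x : E), f (r • x) = r ^ m * f x) :
    ∫ x, f x * Real.exp (-‖x‖ ^ 2) ∂μ =
      (∫ u, f u ∂μ.toSphere) *
        ∫ r in Set.Ioi (0 : ℝ), r ^ (Module.finrank ℝ E - 1 + m) * Real.exp (-r ^ 2) := by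
  calc
    ∫ x, f x * Real.exp (-‖x‖ ^ 2) ∂μ
        = ∫ x : ({(0)}ᶜ : Set E), f x * Real.exp (-‖(x : E)‖ ^ 2) ∂(μ.comap (↑)) := by
      rw [integral_subtype_comap (measurableSet_singleton _).compl
        fun x => f x * Real.exp (-‖x‖ ^ 2), restrict_compl_singleton]
    _ = ∫ p, f p.1 * ((p.2 : ℝ) ^ m * Real.exp (-(p.2 : ℝ) ^ 2))
          ∂μ.toSphere.prod (.volumeIoiPow (Module.finrank ℝ E - 1)) := by
      rw [← μ.measurePreserving_homeomorphUnitSphereProd.integral_comp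
        (Homeomorph.measurableEmbedding _)]
      refine integral_congr_ae (Eventually.of_forall fun x => ?_)
      have hx : ‖(x : E)‖ ≠ 0 := norm_ne_zero_iff.2 x.2
      simp only [homeomorphUnitSphereProd_apply_fst_coe, homeomorphUnitSphereProd_apply_snd_coe, hf]
      rw [inv_pow]
      field_simp
    _ = (∫ u, f u ∂μ.toSphere) * ∫ r : Set.Ioi (0 : ℝ), (r : ℝ) ^ m * Real.exp (-(r : ℝ) ^ 2)
          ∂.volumeIoiPow (Module.finrank ℝ E - 1) :=
      integral_prod_mul (fun u : Metric.sphere (0 : E) 1 => f u)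
        (fun r : Set.Ioi (0 : ℝ) => (r : ℝ) ^ m * Real.exp (-(r : ℝ) ^ 2))
    _ = _ := by
      congr 1
      simp only [Measure.volumeIoiPow, ENNReal.ofReal]
      rw [integral_withDensity_eq_integral_smul,
        integral_subtype_comap measurableSet_Ioi fun a =>
          Real.toNNReal (a ^ (Module.finrank ℝ E - 1)) • (a ^ m * Real.exp (-a ^ 2)),
        setIntegral_congr_fun measurableSet_Ioi fun x hx => ?_]
      · rw [NNReal.smul_def, Real.coe_toNNReal _ (pow_nonneg hx.out.le _), smul_eq_mul, pow_add,
          mul_assoc]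
      · exact (measurable_subtype_coe.pow_const _).real_toNNReal

/-- Gaussian moments in a direction: by rotation invariance, the direction may be taken to be a
coordinate axis, where the integral is a product. -/
lemma integral_inner_pow_mul_exp_neg_sq {n : ℕ} (m : ℕ) {e : EuclideanSpace ℝ (Fin (n + 1))}
    (he : ‖e‖ = 1) :
    ∫ x : EuclideanSpace ℝ (Fin (n + 1)), inner ℝ e x ^ m * Real.exp (-‖x‖ ^ 2) =
      (∫ t : ℝ, t ^ m * Real.exp (-t ^ 2)) * (∫ t : ℝ, Real.exp (-t ^ 2)) ^ n := by
  obtain ⟨b, hb⟩ := Orthonormal.exists_orthonormalBasis_extension_of_card_eq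
    (𝕜 := ℝ) (E := EuclideanSpace ℝ (Fin (n + 1))) (ι := Fin (n + 1)) (by simp)
    (v := fun _ => e) (s := {0}) (by
      rw [orthonormal_iff_ite]
      rintro ⟨i, rfl⟩ ⟨j, rfl⟩
      simp [he])
  have hb0 : b 0 = e := hb 0 rfl
  have h1 : ∫ x : EuclideanSpace ℝ (Fin (n + 1)), inner ℝ e x ^ m * Real.exp (-‖x‖ ^ 2) =
      ∫ y : EuclideanSpace ℝ (Fin (n + 1)), y 0 ^ m * Real.exp (-‖y‖ ^ 2) := by
    rw [← b.measurePreserving_repr.integral_comp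
      b.repr.toHomeomorph.measurableEmbedding (fun y => y 0 ^ m * Real.exp (-‖y‖ ^ 2))]
    refine integral_congr_ae (Eventually.of_forall fun x => ?_)
    simp only [LinearIsometryEquiv.norm_map, b.repr_apply_apply, hb0]
  have h2 : ∫ y : EuclideanSpace ℝ (Fin (n + 1)), y 0 ^ m * Real.exp (-‖y‖ ^ 2) =
      ∫ y : Fin (n + 1) → ℝ, ∏ i, (if i = 0 then y i ^ m * Real.exp (-y i ^ 2)
        else Real.exp (-y i ^ 2)) := by
    rw [← (PiLp.volume_preserving_toLp (Fin (n + 1))).integral_comp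
      (MeasurableEquiv.toLp 2 (Fin (n + 1) → ℝ)).measurableEmbedding]
    refine integral_congr_ae (Eventually.of_forall fun y => ?_)
    simp only [EuclideanSpace.norm_sq_eq, Fin.prod_univ_succ, if_true, Fin.succ_ne_zero, if_false,
      Fin.sum_univ_succ, neg_add, Real.exp_add, ← Finset.sum_neg_distrib, Real.exp_sum,
      Real.norm_eq_abs, sq_abs, mul_assoc]
  rw [h1, h2, integral_fintype_prod_volume_eq_prod
    (fun (i : Fin (n + 1)) (t : ℝ) => if i = 0 then t ^ m * Real.exp (-t ^ 2)
      else Real.exp (-t ^ 2))]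
  simp [Fin.prod_univ_succ, Fin.succ_ne_zero]

/-- Integration by parts, from the derivative of `cos ^ (2ν+1) φ sin ^ (m+1) φ`. -/
lemma integral_sin_pow_mul_cos_pow_add_two (ν m : ℕ) :
    (m + 2 + 2 * ν) *
        ∫ φ in (-(Real.pi / 2))..(Real.pi / 2), Real.cos φ ^ (2 * ν) * Real.sin φ ^ (m + 2) =
      (m + 1) * ∫ φ in (-(Real.pi / 2))..(Real.pi / 2), Real.cos φ ^ (2 * ν) * Real.sin φ ^ m := by
  have hd : ∀ φ : ℝ, HasDerivAt (fun φ => Real.cos φ ^ (2 * ν + 1) * Real.sin φ ^ (m + 1))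
      ((m + 1) * (Real.cos φ ^ (2 * ν) * Real.sin φ ^ m) -
        (m + 2 + 2 * ν) * (Real.cos φ ^ (2 * ν) * Real.sin φ ^ (m + 2))) φ := by
    intro φ
    refine (((Real.hasDerivAt_cos φ).fun_pow (2 * ν + 1)).fun_mul
      ((Real.hasDerivAt_sin φ).fun_pow (m + 1))).congr_deriv ?_
    have hcs := Real.sin_sq_add_cos_sq φ
    simp only [Nat.add_sub_cancel, pow_succ]
    push_cast
    linear_combination ((m + 1) * Real.cos φ ^ (2 * ν) * Real.sin φ ^ m) * hcs
  have hint := intervalIntegral.integral_eq_sub_of_hasDerivAt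
    (a := -(Real.pi / 2)) (b := Real.pi / 2) (fun φ _ => hd φ)
    (Continuous.intervalIntegrable (by fun_prop) _ _)
  rw [intervalIntegral.integral_sub (Continuous.intervalIntegrable (by fun_prop) _ _)
    (Continuous.intervalIntegrable (by fun_prop) _ _),
    intervalIntegral.integral_const_mul, intervalIntegral.integral_const_mul,
    Real.cos_neg, Real.cos_pi_div_two, zero_pow (by omega), zero_mul, zero_mul, sub_zero] at hint
  linarith

/-- The moments of a coordinate on the sphere in dimension `2ν + 2` are those of `sin φ` for the
weight `cos ^ (2ν) φ`: both sequences satisfy the same recurrence. -/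
lemma integral_toSphere_inner_pow (ν m : ℕ) {e : EuclideanSpace ℝ (Fin (2 * ν + 2))}
    (he : ‖e‖ = 1) :
    cosMass ν * ∫ u, inner ℝ e (u : EuclideanSpace ℝ (Fin (2 * ν + 2))) ^ m
        ∂(volume : Measure (EuclideanSpace ℝ (Fin (2 * ν + 2)))).toSphere =
      (volume : Measure (EuclideanSpace ℝ (Fin (2 * ν + 2)))).toSphere.real Set.univ *
        ∫ φ in (-(Real.pi / 2))..(Real.pi / 2), Real.cos φ ^ (2 * ν) * Real.sin φ ^ m := by
  have polar : ∀ m : ℕ, (∫ t : ℝ, t ^ m * Real.exp (-t ^ 2)) *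
      (∫ t : ℝ, Real.exp (-t ^ 2)) ^ (2 * ν + 1) =
      (∫ u, inner ℝ e (u : EuclideanSpace ℝ (Fin (2 * ν + 2))) ^ m
        ∂(volume : Measure (EuclideanSpace ℝ (Fin (2 * ν + 2)))).toSphere) *
        ∫ r in Set.Ioi (0 : ℝ), r ^ (2 * ν + 1 + m) * Real.exp (-r ^ 2) := by
    intro m
    have h := integral_homogeneous_mul_exp_neg_sq
      (volume : Measure (EuclideanSpace ℝ (Fin (2 * ν + 2)))) m (fun x => inner ℝ e x ^ m)
      (fun r x => by rw [real_inner_smul_right, mul_pow])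
    rw [← integral_inner_pow_mul_exp_neg_sq m he, h]
    simp
  induction m using Nat.twoStepInduction with
  | zero => simp [cosMass, mul_comm]
  | one =>
    have h := polar 1
    rw [integral_pow_mul_exp_neg_sq_of_odd odd_one, zero_mul] at h
    have h1 := (mul_eq_zero.1 h.symm).resolve_right (integral_Ioi_pow_mul_exp_neg_sq_pos _).ne'
    rw [h1, mul_zero]
    simp only [pow_one]
    rw [integral_cos_pow_mul_sin, mul_zero]
  | more m ih _ =>
    have h := polar m
    have h2 := polar (m + 2)
    rw [integral_pow_mul_exp_neg_sq_add_two, ← add_assoc,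
      integral_Ioi_pow_mul_exp_neg_sq_add_two, mul_assoc, h] at h2
    have hT := integral_sin_pow_mul_cos_pow_add_two ν m
    have hR := (integral_Ioi_pow_mul_exp_neg_sq_pos (2 * ν + 1 + m)).ne'
    have h3 : (m + 1) * ∫ u, inner ℝ e (u : EuclideanSpace ℝ (Fin (2 * ν + 2))) ^ m
        ∂(volume : Measure (EuclideanSpace ℝ (Fin (2 * ν + 2)))).toSphere =
        (m + 2 + 2 * ν) * ∫ u, inner ℝ e (u : EuclideanSpace ℝ (Fin (2 * ν + 2))) ^ (m + 2)
        ∂(volume : Measure (EuclideanSpace ℝ (Fin (2 * ν + 2)))).toSphere := by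
      apply mul_right_cancel₀ hR
      push_cast at h2
      linear_combination 2 * h2
    have hpos : (m + 2 + 2 * ν : ℝ) ≠ 0 := by positivity
    apply mul_left_cancel₀ hpos
    linear_combination (-cosMass ν) * h3 + (m + 1) * ih -
      (volume : Measure (EuclideanSpace ℝ (Fin (2 * ν + 2)))).toSphere.real Set.univ * hT

/-! ### Even moments by averaging over one step at a time -/

noncomputable section

/-- The average over a uniform unit step in `ℝ^(2ν+2)` of a function `G` of the squared distance,
as a function of the squared distance `s` before the step. -/
def stepAverage (ν : ℕ) (G : ℝ → ℝ) (s : ℝ) : ℝ :=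
  (cosMass ν)⁻¹ * ∫ φ in (-(Real.pi / 2))..(Real.pi / 2),
    Real.cos φ ^ (2 * ν) * G (1 + s + 2 * Real.sqrt s * Real.sin φ)

end

lemma integral_uniformStep (d : ℕ) (f : EuclideanSpace ℝ (Fin d) → ℝ) :
    ∫ x, f x ∂uniformStep d =
      ((volume : Measure (EuclideanSpace ℝ (Fin d))).toSphere.real Set.univ)⁻¹ *
        ∫ u, f u ∂(volume : Measure (EuclideanSpace ℝ (Fin d))).toSphere := by
  rw [uniformStep, (MeasurableEmbedding.subtype_coe
    Metric.isClosed_sphere.measurableSet).integral_map]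
  simp [integral_smul_measure, Measure.real]

instance isProbabilityMeasure_uniformStep (n : ℕ) : IsProbabilityMeasure (uniformStep (n + 1)) := by
  have h : (volume : Measure (EuclideanSpace ℝ (Fin (n + 1)))).toSphere ≠ 0 :=
    Measure.toSphere_ne_zero _
  refine ⟨?_⟩
  simp only [uniformStep]
  rw [Measure.map_apply measurable_subtype_coe MeasurableSet.univ]
  simp only [Set.preimage_univ, Measure.smul_apply, smul_eq_mul]
  exact ENNReal.inv_mul_cancel (Measure.measure_univ_ne_zero.2 h) (measure_ne_top _ _)

instance isProbabilityMeasure_uniformStep_even (ν : ℕ) :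
    IsProbabilityMeasure (uniformStep (2 * ν + 2)) :=
  isProbabilityMeasure_uniformStep (2 * ν + 1)

lemma ae_norm_eq_one_uniformStep (d : ℕ) : ∀ᵐ x ∂uniformStep d, ‖x‖ = 1 := by
  rw [uniformStep, (MeasurableEmbedding.subtype_coe
    Metric.isClosed_sphere.measurableSet).ae_map_iff]
  exact Eventually.of_forall fun u => by simp

/-- A continuous function is integrable for a finite measure with bounded support. -/
lemma Continuous.integrable_of_ae_norm_le {E : Type*} [NormedAddCommGroup E] [ProperSpace E]
    [MeasurableSpace E] [BorelSpace E] {μ : Measure E} [IsFiniteMeasure μ] {f : E → ℝ}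
    (hf : Continuous f) {R : ℝ} (h : ∀ᵐ x ∂μ, ‖x‖ ≤ R) : Integrable f μ := by
  obtain ⟨C, hC⟩ := (isCompact_closedBall (0 : E) R).exists_bound_of_continuousOn hf.continuousOn
  exact Integrable.of_bound hf.aestronglyMeasurable C
    (h.mono fun x hx => hC x (by simpa using hx))

lemma Continuous.integrable_uniformStep {n : ℕ} {f : EuclideanSpace ℝ (Fin (n + 1)) → ℝ}
    (hf : Continuous f) : Integrable f (uniformStep (n + 1)) :=
  hf.integrable_of_ae_norm_le ((ae_norm_eq_one_uniformStep _).mono fun _ h => h.le)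

lemma integral_uniformStep_inner_pow (ν m : ℕ) (v : EuclideanSpace ℝ (Fin (2 * ν + 2))) :
    ∫ x, inner ℝ v x ^ m ∂uniformStep (2 * ν + 2) =
      (cosMass ν)⁻¹ * ∫ φ in (-(Real.pi / 2))..(Real.pi / 2),
        Real.cos φ ^ (2 * ν) * (‖v‖ * Real.sin φ) ^ m := by
  obtain ⟨e, he, hv⟩ : ∃ e : EuclideanSpace ℝ (Fin (2 * ν + 2)), ‖e‖ = 1 ∧ v = ‖v‖ • e := by
    rcases eq_or_ne v 0 with rfl | hv
    · exact ⟨EuclideanSpace.single 0 1, by simp, by simp⟩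
    · refine ⟨‖v‖⁻¹ • v, ?_, ?_⟩
      · rw [norm_smul, norm_inv, norm_norm, inv_mul_cancel₀ (norm_ne_zero_iff.2 hv)]
      · rw [smul_inv_smul₀ (norm_ne_zero_iff.2 hv)]
  have hσ : (volume : Measure (EuclideanSpace ℝ (Fin (2 * ν + 2)))).toSphere.real Set.univ ≠ 0 := by
    rw [Measure.real, Ne, ENNReal.toReal_eq_zero_iff]
    simp only [Measure.measure_univ_eq_zero, measure_ne_top, or_false]
    exact Measure.toSphere_ne_zero _
  have h := integral_toSphere_inner_pow ν m he
  have hB := (cosMass_pos ν).ne'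
  have h1 : ∀ x : EuclideanSpace ℝ (Fin (2 * ν + 2)),
      inner ℝ v x ^ m = ‖v‖ ^ m * inner ℝ e x ^ m := by
    intro x
    conv_lhs => rw [hv]
    rw [real_inner_smul_left, mul_pow]
  have h2 : ∀ φ : ℝ, Real.cos φ ^ (2 * ν) * (‖v‖ * Real.sin φ) ^ m =
      ‖v‖ ^ m * (Real.cos φ ^ (2 * ν) * Real.sin φ ^ m) := fun φ => by ring
  simp_rw [h1, h2]
  rw [integral_const_mul, intervalIntegral.integral_const_mul, integral_uniformStep]
  field_simp
  linear_combination (‖v‖ ^ m) * h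

/-- The law of `⟨v, X⟩` for a uniform unit step `X`. Both sides are averages over
`[-‖v‖, ‖v‖]` which agree on powers, hence on polynomials, hence on continuous functions. -/
lemma integral_uniformStep_comp_inner (ν : ℕ) (v : EuclideanSpace ℝ (Fin (2 * ν + 2))) {f : ℝ → ℝ}
    (hf : Continuous f) :
    ∫ x, f (inner ℝ v x) ∂uniformStep (2 * ν + 2) =
      (cosMass ν)⁻¹ * ∫ φ in (-(Real.pi / 2))..(Real.pi / 2),
        Real.cos φ ^ (2 * ν) * f (‖v‖ * Real.sin φ) := by
  have hB := cosMass_pos ν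
  have hπ : -(Real.pi / 2) ≤ Real.pi / 2 := by linarith [Real.pi_pos]
  have hpoly : ∀ p : Polynomial ℝ, ∫ x, p.eval (inner ℝ v x) ∂uniformStep (2 * ν + 2) =
      (cosMass ν)⁻¹ * ∫ φ in (-(Real.pi / 2))..(Real.pi / 2),
        Real.cos φ ^ (2 * ν) * p.eval (‖v‖ * Real.sin φ) := by
    intro p
    induction p using Polynomial.induction_on' with
    | add p q hp hq =>
      simp only [Polynomial.eval_add, mul_add]
      rw [integral_add, intervalIntegral.integral_add, hp, hq, mul_add]
      · exact Continuous.intervalIntegrable (by fun_prop) _ _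
      · exact Continuous.intervalIntegrable (by fun_prop) _ _
      · exact Continuous.integrable_uniformStep (by fun_prop)
      · exact Continuous.integrable_uniformStep (by fun_prop)
    | monomial n a =>
      simp only [Polynomial.eval_monomial, mul_left_comm _ a]
      rw [integral_const_mul, intervalIntegral.integral_const_mul,
        integral_uniformStep_inner_pow, mul_left_comm]
  refine eq_of_abs_sub_le_all fun ε hε => ?_
  obtain ⟨p, hp⟩ := exists_polynomial_near_of_continuousOn (-‖v‖) ‖v‖ f hf.continuousOn (ε / 2)
    (by positivity)
  have h1 : |∫ x, f (inner ℝ v x) ∂uniformStep (2 * ν + 2) -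
      ∫ x, p.eval (inner ℝ v x) ∂uniformStep (2 * ν + 2)| ≤ ε / 2 := by
    rw [← integral_sub (Continuous.integrable_uniformStep (by fun_prop))
      (Continuous.integrable_uniformStep (by fun_prop)), ← Real.norm_eq_abs]
    have := norm_integral_le_of_norm_le_const (μ := uniformStep (2 * ν + 2)) (C := ε / 2)
      (f := fun x => f (inner ℝ v x) - p.eval (inner ℝ v x)) (by
        filter_upwards [ae_norm_eq_one_uniformStep (2 * ν + 2)] with x hx
        rw [Real.norm_eq_abs, abs_sub_comm]
        refine (hp _ ?_).le
        have := abs_real_inner_le_norm v x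
        rw [hx, mul_one] at this
        exact abs_le.1 this)
    simpa using this
  have h2 : |((cosMass ν)⁻¹ * ∫ φ in (-(Real.pi / 2))..(Real.pi / 2),
        Real.cos φ ^ (2 * ν) * p.eval (‖v‖ * Real.sin φ)) -
      (cosMass ν)⁻¹ * ∫ φ in (-(Real.pi / 2))..(Real.pi / 2),
        Real.cos φ ^ (2 * ν) * f (‖v‖ * Real.sin φ)| ≤ ε / 2 := by
    rw [← mul_sub, ← intervalIntegral.integral_sub (Continuous.intervalIntegrable (by fun_prop) _ _)
      (Continuous.intervalIntegrable (by fun_prop) _ _), abs_mul, abs_of_pos (inv_pos.2 hB),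
      inv_mul_le_iff₀ hB, cosMass, ← intervalIntegral.integral_mul_const, ← Real.norm_eq_abs]
    refine intervalIntegral.norm_integral_le_of_norm_le hπ
      (Eventually.of_forall fun φ _ => ?_) (Continuous.intervalIntegrable (by fun_prop) _ _)
    have hc : 0 ≤ Real.cos φ ^ (2 * ν) := (even_two_mul ν).pow_nonneg _
    rw [← mul_sub, norm_mul, Real.norm_eq_abs, Real.norm_eq_abs, abs_of_nonneg hc]
    refine mul_le_mul_of_nonneg_left (hp _ ?_).le hc
    exact ⟨by nlinarith [norm_nonneg v, Real.neg_one_le_sin φ],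
      by nlinarith [norm_nonneg v, Real.sin_le_one φ]⟩
  rw [hpoly] at h1
  have := abs_sub_le (∫ x, f (inner ℝ v x) ∂uniformStep (2 * ν + 2)) _
    ((cosMass ν)⁻¹ * ∫ φ in (-(Real.pi / 2))..(Real.pi / 2),
        Real.cos φ ^ (2 * ν) * f (‖v‖ * Real.sin φ)) |>.trans (add_le_add h1 h2)
  linarith

lemma integral_uniformStep_norm_add_sq (ν : ℕ) (a : EuclideanSpace ℝ (Fin (2 * ν + 2)))
    {G : ℝ → ℝ} (hG : Continuous G) :
    ∫ x, G (‖x + a‖ ^ 2) ∂uniformStep (2 * ν + 2) = stepAverage ν G (‖a‖ ^ 2) := by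
  have h1 : ∫ x, G (‖x + a‖ ^ 2) ∂uniformStep (2 * ν + 2) =
      ∫ x, G (1 + ‖a‖ ^ 2 + 2 * inner ℝ a x) ∂uniformStep (2 * ν + 2) := by
    refine integral_congr_ae ?_
    filter_upwards [ae_norm_eq_one_uniformStep (2 * ν + 2)] with x hx
    rw [add_comm x a, norm_add_sq_real, hx]
    congr 1
    ring
  rw [h1, integral_uniformStep_comp_inner ν a (f := fun t => G (1 + ‖a‖ ^ 2 + 2 * t))
    (by fun_prop), stepAverage, Real.sqrt_sq (norm_nonneg a)]
  simp only [mul_assoc]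

lemma continuous_stepAverage (ν : ℕ) {G : ℝ → ℝ} (hG : Continuous G) :
    Continuous (stepAverage ν G) := by
  refine continuous_const.mul
    (intervalIntegral.continuous_parametric_intervalIntegral_of_continuous' ?_ _ _)
  simp only [Function.uncurry_def]
  fun_prop

lemma ae_pi_norm_le {E : Type*} [NormedAddCommGroup E] [MeasurableSpace E] {μ : Measure E}
    [IsProbabilityMeasure μ] (h : ∀ᵐ x ∂μ, ‖x‖ ≤ 1) (n : ℕ) :
    ∀ᵐ ω ∂Measure.pi fun _ : Fin n => μ, ‖ω‖ ≤ 1 := by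
  have h' : ∀ᵐ ω ∂Measure.pi fun _ : Fin n => μ, ∀ i, ‖ω i‖ ≤ 1 := by
    rw [ae_all_iff]
    exact fun i => (measurePreserving_eval (fun _ : Fin n => μ) i).quasiMeasurePreserving.ae h
  filter_upwards [h'] with ω hω
  exact (pi_norm_le_iff_of_nonneg zero_le_one).2 hω

/-- Conditioning a walk on all its steps but the first. -/
lemma integral_pi_sum_succ {E : Type*} [NormedAddCommGroup E] [ProperSpace E] [MeasurableSpace E]
    [BorelSpace E] {μ : Measure E} [IsProbabilityMeasure μ] (h : ∀ᵐ x ∂μ, ‖x‖ ≤ 1) (n : ℕ)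
    {f : E → ℝ} (hf : Continuous f) :
    ∫ ω, f (∑ i, ω i) ∂(Measure.pi fun _ : Fin (n + 1) => μ) =
      ∫ ω, ∫ x, f (x + ∑ i, ω i) ∂μ ∂(Measure.pi fun _ : Fin n => μ) := by
  have hmp := measurePreserving_piFinSuccAbove (fun _ : Fin (n + 1) => μ) 0
  have h1 : ∫ ω, f (∑ i, ω i) ∂(Measure.pi fun _ : Fin (n + 1) => μ) =
      ∫ p : E × (Fin n → E), f (p.1 + ∑ i, p.2 i)
        ∂(μ.prod (Measure.pi fun _ : Fin n => μ)) := by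
    rw [← hmp.integral_comp' (g := fun p : E × (Fin n → E) => f (p.1 + ∑ i, p.2 i))]
    refine integral_congr_ae (Eventually.of_forall fun ω => ?_)
    simp [MeasurableEquiv.piFinSuccAbove, Fin.sum_univ_succ, Fin.tail]
  rw [h1, integral_prod_symm]
  refine Continuous.integrable_of_ae_norm_le (R := 1) (by fun_prop) ?_
  have e1 := (measurePreserving_fst (μ := μ)
    (ν := Measure.pi fun _ : Fin n => μ)).quasiMeasurePreserving.ae h
  have e2 := (measurePreserving_snd (μ := μ)
    (ν := Measure.pi fun _ : Fin n => μ)).quasiMeasurePreserving.ae (ae_pi_norm_le h n)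
  filter_upwards [e1, e2] with p h1 h2
  exact max_le h1 h2

/-- The even moments after `n` steps, by averaging over one step at a time. -/
lemma walkMoment_even (ν n k : ℕ) :
    walkMoment n (2 * ν + 2) (2 * (k : ℝ)) =
      ((stepAverage ν)^[n] fun s => s ^ k) 0 := by
  have h1 : walkMoment n (2 * ν + 2) (2 * (k : ℝ)) =
      ∫ ω, (‖∑ i, ω i‖ ^ 2) ^ k ∂(Measure.pi fun _ : Fin n => uniformStep (2 * ν + 2)) := by
    rw [walkMoment, walkDistance, integral_map (by fun_prop)]
    · refine integral_congr_ae (Eventually.of_forall fun ω => ?_)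
      simp only []
      rw [← pow_mul, ← Real.rpow_natCast]
      push_cast
      rfl
    · refine Measurable.aestronglyMeasurable ?_
      fun_prop
  have h2 : ∀ (m : ℕ) (G : ℝ → ℝ), Continuous G →
      ∫ ω, G (‖∑ i, ω i‖ ^ 2) ∂(Measure.pi fun _ : Fin m => uniformStep (2 * ν + 2)) =
        ((stepAverage ν)^[m] G) 0 := by
    intro m
    induction m with
    | zero => intro G _; simp
    | succ m ih =>
      intro G hG
      rw [integral_pi_sum_succ ((ae_norm_eq_one_uniformStep _).mono fun _ h => h.le) m
        (f := fun x => G (‖x‖ ^ 2)) (by fun_prop)]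
      simp only [integral_uniformStep_norm_add_sq ν _ hG]
      rw [ih _ (continuous_stepAverage ν hG), Function.iterate_succ_apply]
  rw [h1]
  exact h2 n (fun s => s ^ k) (by fun_prop)

/-! ### The generating function of the moments -/

lemma abs_cosMass_inv_mul_integral_le (ν : ℕ) {a : ℝ → ℝ} {M : ℝ} (hM : ∀ φ, |a φ| ≤ M) :
    |(cosMass ν)⁻¹ * ∫ φ in (-(Real.pi / 2))..(Real.pi / 2), Real.cos φ ^ (2 * ν) * a φ| ≤ M := by
  have hB := cosMass_pos ν
  have hπ : -(Real.pi / 2) ≤ Real.pi / 2 := by linarith [Real.pi_pos]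
  rw [abs_mul, abs_of_pos (inv_pos.2 hB), inv_mul_le_iff₀ hB, cosMass,
    ← intervalIntegral.integral_mul_const, ← Real.norm_eq_abs]
  refine intervalIntegral.norm_integral_le_of_norm_le hπ
    (Eventually.of_forall fun φ _ => ?_) (Continuous.intervalIntegrable (by fun_prop) _ _)
  have hc : 0 ≤ Real.cos φ ^ (2 * ν) := (even_two_mul ν).pow_nonneg _
  rw [norm_mul, Real.norm_eq_abs, Real.norm_eq_abs, abs_of_nonneg hc]
  exact mul_le_mul_of_nonneg_left (hM φ) hc

/-- Integrating a family of power series with coefficients bounded by `9 ^ k` against the weight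
`cos ^ (2ν)`. -/
lemma hasSum_cos_weight_integral (ν : ℕ) {x : ℂ} (hx : ‖x‖ < 1 / 9) {a : ℕ → ℝ → ℝ} {g : ℝ → ℂ}
    (ha : ∀ k, Continuous (a k)) (hbd : ∀ k φ, |a k φ| ≤ 9 ^ k)
    (hsum : ∀ φ, HasSum (fun k => (a k φ : ℂ) * x ^ k) (g φ)) :
    HasSum (fun k => (((cosMass ν)⁻¹ * ∫ φ in (-(Real.pi / 2))..(Real.pi / 2),
        Real.cos φ ^ (2 * ν) * a k φ : ℝ) : ℂ) * x ^ k)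
      ((cosMass ν : ℂ)⁻¹ * ∫ φ in (-(Real.pi / 2))..(Real.pi / 2),
        (Real.cos φ : ℂ) ^ (2 * ν) * g φ) := by
  have hgeo : Summable fun k : ℕ => (9 * ‖x‖) ^ k :=
    summable_geometric_of_lt_one (by positivity) (by linarith)
  have key : HasSum (fun k => ∫ φ in (-(Real.pi / 2))..(Real.pi / 2),
      (Real.cos φ : ℂ) ^ (2 * ν) * ((a k φ : ℂ) * x ^ k))
      (∫ φ in (-(Real.pi / 2))..(Real.pi / 2), (Real.cos φ : ℂ) ^ (2 * ν) * g φ) := by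
    refine intervalIntegral.hasSum_integral_of_dominated_convergence
      (fun k _ => (9 * ‖x‖) ^ k) (fun k => ?_) (fun k => Eventually.of_forall fun φ _ => ?_)
      (Eventually.of_forall fun _ _ => hgeo) intervalIntegrable_const
      (Eventually.of_forall fun φ _ => (hsum φ).mul_left _)
    · have := ha k
      exact Continuous.aestronglyMeasurable (by fun_prop)
    · rw [norm_mul, norm_mul, norm_pow, norm_pow, Complex.norm_real, Complex.norm_real, mul_pow,
        Real.norm_eq_abs, Real.norm_eq_abs]
      have h1 : |Real.cos φ| ^ (2 * ν) ≤ 1 := pow_le_one₀ (abs_nonneg _) (Real.abs_cos_le_one φ)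
      have h2 := mul_le_mul_of_nonneg_right (hbd k φ) (pow_nonneg (norm_nonneg x) k)
      have h3 : 0 ≤ |a k φ| * ‖x‖ ^ k := by positivity
      exact (mul_le_of_le_one_left h3 h1).trans h2
  refine (key.mul_left (cosMass ν : ℂ)⁻¹).congr_fun fun k => ?_
  push_cast
  rw [← intervalIntegral.integral_ofReal, mul_assoc, ← intervalIntegral.integral_mul_const]
  congr 1
  refine intervalIntegral.integral_congr fun φ _ => ?_
  push_cast
  ring

/-- The third step of the walk, summed over all moments. -/
lemma hasSum_stepAverage_pow (ν : ℕ) {x : ℂ} (hx : ‖x‖ < 1 / 9) {s : ℝ}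
    (hs : s ∈ Set.Icc (0 : ℝ) 4) :
    HasSum (fun k : ℕ => (stepAverage ν (fun t => t ^ k) s : ℂ) * x ^ k)
      ((cosMass ν : ℂ)⁻¹ * stepResolvent ν x s) := by
  have h := hasSum_cos_weight_integral ν hx
    (a := fun k φ => (1 + s + 2 * Real.sqrt s * Real.sin φ) ^ k)
    (g := fun φ => (1 - x * (1 + s + 2 * Real.sqrt s * Real.sin φ : ℝ))⁻¹) (by fun_prop) ?_ ?_
  · simpa only [stepAverage, stepResolvent, div_eq_mul_inv] using h
  · intro k φ
    have := step_sq_mem hs φ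
    rw [abs_pow, abs_of_nonneg this.1]
    exact pow_le_pow_left₀ this.1 this.2 k
  · intro φ
    have he := step_sq_mem hs φ
    have hlt : ‖x * (1 + s + 2 * Real.sqrt s * Real.sin φ : ℝ)‖ < 1 := by
      rw [norm_mul, Complex.norm_real, Real.norm_eq_abs, abs_of_nonneg he.1]
      nlinarith [norm_nonneg x, he.1, he.2]
    refine (hasSum_geometric_of_norm_lt_one hlt).congr_fun fun k => ?_
    rw [mul_pow, Complex.ofReal_pow, mul_comm]

lemma abs_stepAverage_pow_le (ν k : ℕ) {s : ℝ} (hs : s ∈ Set.Icc (0 : ℝ) 4) :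
    |stepAverage ν (fun t => t ^ k) s| ≤ 9 ^ k := by
  refine abs_cosMass_inv_mul_integral_le ν
    (a := fun φ => (1 + s + 2 * Real.sqrt s * Real.sin φ) ^ k) fun φ => ?_
  have := step_sq_mem hs φ
  rw [abs_pow, abs_of_nonneg this.1]
  exact pow_le_pow_left₀ this.1 this.2 k

/-- The first step leads to distance `1` from the origin, and the second one to the squared distance
`2 + 2 sin θ`. -/
lemma walkMoment_three (ν k : ℕ) :
    walkMoment 3 (2 * ν + 2) (2 * (k : ℝ)) =
      (cosMass ν)⁻¹ * ∫ θ in (-(Real.pi / 2))..(Real.pi / 2),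
        Real.cos θ ^ (2 * ν) * stepAverage ν (fun t => t ^ k) (2 + 2 * Real.sin θ) := by
  have hB := (cosMass_pos ν).ne'
  have h0 : ∀ G : ℝ → ℝ, stepAverage ν G 0 = G 1 := fun G => by
    have : stepAverage ν G 0 = (cosMass ν)⁻¹ * (cosMass ν * G 1) := by
      rw [stepAverage, cosMass, ← intervalIntegral.integral_mul_const]
      simp
    rw [this, inv_mul_cancel_left₀ hB]
  rw [walkMoment_even]
  simp only [Function.iterate_succ_apply', Function.iterate_zero_apply]
  rw [h0, stepAverage]
  norm_num

/-- The generating function of the even moments is the resolvent of the walk. -/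
lemma hasSum_walkMoment_three (ν : ℕ) {x : ℂ} (hx : ‖x‖ < 1 / 9) :
    HasSum (fun k : ℕ => (walkMoment 3 (2 * ν + 2) (2 * (k : ℝ)) : ℂ) * x ^ k)
      ((cosMass ν : ℂ)⁻¹ ^ 2 * walkResolvent ν x) := by
  have h := hasSum_cos_weight_integral ν hx
    (a := fun k θ => stepAverage ν (fun t => t ^ k) (2 + 2 * Real.sin θ))
    (g := fun θ => (cosMass ν : ℂ)⁻¹ * stepResolvent ν x (2 + 2 * Real.sin θ))
    (fun k => (continuous_stepAverage ν (by fun_prop)).comp (by fun_prop))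
    (fun k θ => abs_stepAverage_pow_le ν k (two_add_two_sin_mem θ))
    (fun θ => hasSum_stepAverage_pow ν hx (two_add_two_sin_mem θ))
  simp only [← walkMoment_three] at h
  convert h using 1
  rw [walkResolvent, pow_two, mul_assoc, ← intervalIntegral.integral_const_mul]
  congr 1
  refine intervalIntegral.integral_congr fun θ _ => ?_
  ring

/-- The generating function is analytic for `|x| < 1/9`, since `0 ≤ R² ≤ 9` for three steps. -/
lemma analyticOnNhd_walkResolvent (ν : ℕ) :
    AnalyticOnNhd ℂ (fun x => (cosMass ν : ℂ)⁻¹ ^ 2 * walkResolvent ν x)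
      (Metric.ball (0 : ℂ) (1 / 9)) := by
  set p := FormalMultilinearSeries.ofScalars ℂ
    fun k : ℕ => (walkMoment 3 (2 * ν + 2) (2 * (k : ℝ)) : ℂ) with hp
  have hball : Metric.eball (0 : ℂ) ((1 / 9 : NNReal) : ENNReal) = Metric.ball (0 : ℂ) (1 / 9) := by
    rw [Metric.eball_coe]
    norm_num
  have hps : HasFPowerSeriesOnBall (fun x => (cosMass ν : ℂ)⁻¹ ^ 2 * walkResolvent ν x) p 0
      ((1 / 9 : NNReal) : ENNReal) := by
    refine ⟨FormalMultilinearSeries.le_radius_of_bound p 1 fun k => ?_, by norm_num,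
      fun {y} hy => ?_⟩
    · have hW : |walkMoment 3 (2 * ν + 2) (2 * (k : ℝ))| ≤ 9 ^ k := by
        rw [walkMoment_three]
        exact abs_cosMass_inv_mul_integral_le ν fun θ =>
          abs_stepAverage_pow_le ν k (two_add_two_sin_mem θ)
      rw [hp, FormalMultilinearSeries.ofScalars_norm, Complex.norm_real, Real.norm_eq_abs]
      refine (mul_le_mul_of_nonneg_right hW (by positivity)).trans ?_
      rw [← mul_pow]
      norm_num
    · rw [hball] at hy
      rw [zero_add]
      refine (hasSum_walkMoment_three ν (by simpa using hy)).congr_fun fun k => ?_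
      rw [hp, FormalMultilinearSeries.ofScalars_apply_eq, smul_eq_mul]
  rw [← hball]
  exact hps.analyticOnNhd

/-- The identity between the generating function and the hypergeometric term, cleared of the powers
of `x` in denominators. It holds near `0`, and both sides are analytic for `|x| < 1/9`. -/
lemma exists_pow_mul_walkResolvent_eq (ν : ℕ) :
    ∃ b : ℕ → ℂ, ∀ x ∈ Metric.ball (0 : ℂ) (1 / 9),
      x ^ (2 * ν) * ((cosMass ν : ℂ)⁻¹ ^ 2 * walkResolvent ν x) =
        (-1) ^ ν / ((2 * ν).choose ν : ℂ) * ((1 - x) ^ (2 * ν) / (1 + 3 * x) *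
          hyp2F1 (1 / 3) (2 / 3) (1 + ν) (hypArg x)) +
        ∑ i ∈ Finset.range (2 * ν), b i * x ^ i := by
  obtain ⟨b, hb⟩ := exists_walkResolvent_eq ν
  obtain ⟨hdiff, hser⟩ := hyp2F1_spec ν
  refine ⟨fun i => ((4 : ℂ) ^ ν)⁻¹ * (cosMass ν : ℂ)⁻¹ ^ 2 * b i, ?_⟩
  have hR : AnalyticOnNhd ℂ (fun x => (-1) ^ ν / ((2 * ν).choose ν : ℂ) *
      ((1 - x) ^ (2 * ν) / (1 + 3 * x) * hyp2F1 (1 / 3) (2 / 3) (1 + ν) (hypArg x)) +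
        ∑ i ∈ Finset.range (2 * ν), ((4 : ℂ) ^ ν)⁻¹ * (cosMass ν : ℂ)⁻¹ ^ 2 * b i * x ^ i)
      (Metric.ball (0 : ℂ) (1 / 9)) := by
    refine DifferentiableOn.analyticOnNhd (fun x hx => ?_) Metric.isOpen_ball
    obtain ⟨h3, hcut⟩ := hypArg_mem_cutPlane (x := x) (by simpa using hx)
    have d1 : DifferentiableAt ℂ (fun x => hyp2F1 (1 / 3) (2 / 3) (1 + ν) (hypArg x)) x :=
      DifferentiableAt.comp x (hdiff.differentiableAt (isOpen_cutPlane.mem_nhds hcut))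
        (hasDerivAt_hypArg h3).differentiableAt
    have d2 : DifferentiableAt ℂ (fun x : ℂ => (1 - x) ^ (2 * ν) / (1 + 3 * x)) x :=
      DifferentiableAt.fun_div (by fun_prop) (by fun_prop) h3
    refine DifferentiableAt.differentiableWithinAt ?_
    exact ((d2.fun_mul d1).const_mul _).fun_add (by fun_prop)
  have hL : AnalyticOnNhd ℂ
      (fun x : ℂ => x ^ (2 * ν) * ((cosMass ν : ℂ)⁻¹ ^ 2 * walkResolvent ν x))
      (Metric.ball (0 : ℂ) (1 / 9)) :=
    (analyticOnNhd_id.pow _).mul (analyticOnNhd_walkResolvent ν)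
  have hB : (cosMass ν : ℂ) ≠ 0 := by exact_mod_cast (cosMass_pos ν).ne'
  refine hL.eqOn_of_preconnected_of_eventuallyEq hR (convex_ball _ _).isPreconnected
    (Metric.mem_ball_self (by norm_num)) ?_
  filter_upwards [periodIntegral_eventually_eq ν, eventually_hypArg_small,
    Metric.ball_mem_nhds (0 : ℂ) (show (0 : ℝ) < 1 / 20 by norm_num)] with x hF hsmall hx
  have h := hb x hx
  rw [hF, hypRegular, ← hser _ hsmall.2.2] at h
  have h4 : (4 : ℂ) ^ ν ≠ 0 := pow_ne_zero _ (by norm_num)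
  have hC : ((2 * ν).choose ν : ℂ) ≠ 0 := by
    exact_mod_cast (Nat.choose_pos (by omega : ν ≤ 2 * ν)).ne'
  have hBC : (cosMass ν : ℂ) * 4 ^ ν = Real.pi * (2 * ν).choose ν := by
    have := cosMass_eq ν
    rw [eq_div_iff (by positivity)] at this
    exact_mod_cast this
  simp_rw [mul_assoc _ (b _)]
  rw [← Finset.mul_sum]
  rw [mul_pow, ← pow_mul] at h
  generalize ∑ i ∈ Finset.range (2 * ν), b i * x ^ i = S at h ⊢
  generalize (1 - x) ^ (2 * ν) / (1 + 3 * x) *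
    hyp2F1 (1 / 3) (2 / 3) (1 + ν) (hypArg x) = T at h ⊢
  have e1 : x ^ (2 * ν) * ((cosMass ν : ℂ)⁻¹ ^ 2 * walkResolvent ν x) =
      ((4 : ℂ) ^ ν)⁻¹ * (cosMass ν : ℂ)⁻¹ ^ 2 * (4 ^ ν * x ^ (2 * ν) * walkResolvent ν x) := by
    field_simp
  rw [e1, h]
  have e2 : ((4 : ℂ) ^ ν)⁻¹ * (cosMass ν : ℂ)⁻¹ * Real.pi = 1 / ((2 * ν).choose ν : ℂ) := by
    field_simp
    linear_combination -hBC
  have e3 : (cosMass ν : ℂ)⁻¹ * cosMass ν = 1 := inv_mul_cancel₀ hB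
  linear_combination ((-1) ^ ν * T) * e2 +
    (((4 : ℂ) ^ ν)⁻¹ * (cosMass ν : ℂ)⁻¹ * Real.pi * (-1) ^ ν * T) * e3

theorem mainTheorem4 (ν : ℕ) :
    IsPrincipalHypergeometric (1 / 3) (2 / 3) (1 + ν) (hyp2F1 (1 / 3) (2 / 3) (1 + ν)) ∧
    (∀ x : ℂ, ‖x‖ < 1 / 9 → 1 + 3 * x ≠ 0 ∧ hypArg x ∈ cutPlane) ∧
    ∃ q : Polynomial ℂ, IsPrincipalPartAtZero (hypTerm ν) q ∧
      ∀ x : ℂ, x ≠ 0 → ‖x‖ < 1 / 9 →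
        HasSum (fun k : ℕ => (walkMoment 3 (2 * ν + 2) (2 * (k : ℝ)) : ℂ) * x ^ k)
          (hypTerm ν x - q.eval (1 / x)) := by
  refine ⟨hyp2F1_spec ν, fun x hx => hypArg_mem_cutPlane hx, ?_⟩
  obtain ⟨b, hb⟩ := exists_pow_mul_walkResolvent_eq ν
  set q : Polynomial ℂ :=
    -∑ i ∈ Finset.range (2 * ν), Polynomial.C (b i) * Polynomial.X ^ (2 * ν - i) with hq
  have key : ∀ x : ℂ, x ≠ 0 → ‖x‖ < 1 / 9 →
      hypTerm ν x - q.eval (1 / x) = (cosMass ν : ℂ)⁻¹ ^ 2 * walkResolvent ν x := by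
    intro x hx0 hx
    have h := hb x (by simpa using hx)
    have hpow : x ^ (2 * ν) ≠ 0 := pow_ne_zero _ hx0
    apply mul_left_cancel₀ hpow
    rw [h, hq, hypTerm]
    simp only [Polynomial.eval_neg, Polynomial.eval_finsetSum, Polynomial.eval_mul,
      Polynomial.eval_C, Polynomial.eval_pow, Polynomial.eval_X, sub_neg_eq_add, mul_add,
      Finset.mul_sum]
    congr 1
    · have e : x ^ (2 * ν) * (1 - 1 / x) ^ (2 * ν) = (1 - x) ^ (2 * ν) := by
        rw [← mul_pow, mul_sub, mul_one_div_cancel hx0, mul_one, ← neg_sub,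
          (even_two_mul ν).neg_pow]
      rw [← e]
      ring
    · refine Finset.sum_congr rfl fun i hi => ?_
      have hi' : i ≤ 2 * ν := (Finset.mem_range.1 hi).le
      have e : x ^ (2 * ν) * (1 / x) ^ (2 * ν - i) = x ^ i := by
        rw [one_div, inv_pow, ← pow_sub_mul_pow x hi', mul_comm (x ^ (2 * ν - i)), mul_assoc,
          mul_inv_cancel₀ (pow_ne_zero _ hx0), mul_one]
      rw [mul_left_comm, e]
  -- only the powers `x⁻¹, …, x^(-2ν)` occur in `q (1 / x)`
  refine ⟨q, ⟨?_, _, (analyticOnNhd_walkResolvent ν) 0 (Metric.mem_ball_self (by norm_num)), ?_⟩,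
    fun x hx0 hx => ?_⟩
  · rw [hq, Polynomial.coeff_neg, Polynomial.finsetSum_coeff, neg_eq_zero]
    refine Finset.sum_eq_zero fun i hi => ?_
    have := Finset.mem_range.1 hi
    rw [Polynomial.coeff_C_mul_X_pow, if_neg (by omega)]
  · filter_upwards [self_mem_nhdsWithin, mem_nhdsWithin_of_mem_nhds
      (Metric.ball_mem_nhds (0 : ℂ) (show (0 : ℝ) < 1 / 9 by norm_num))] with x hx0 hx
    rw [← key x hx0 (by simpa using hx)]
    ring
  · rw [key x hx0 hx]
    exact hasSum_walkMoment_three ν hx
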